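/- Let $\zeta = e^{\pi i/3}$, $\rho = \zeta^2$, $E = \mathbb{C}/\mathbb{Z}[\rho]$ and $A = E \times E = \mathbb{C}^2/\mathbb{Z}[\rho]^2$ with coordinates $[z,w]$. Consider the elliptic curves $$T_0 = \{w = 0\},\quad T_\infty = \{z = 0\},\quad T_1 = \{w = z\},\quad T_\zeta = \{w = \zeta z\}$$ in $A$. Let $A^*$ be the blowup of $A$ at $[0,0]$, let $D \subset A^*$ be the proper transform of $T_0 + T_\infty + T_1 + T_\zeta$, and let $Y = A^* \smallsetminus D$ (Hirzebruch's ball quotient). Let $v_1 = (1,0)$, $v_2 = (\rho,0)$, $v_3 = (0,1)$, $v_4 = (0,\rho)$ be the standard generators of $\pi_1(A) = \mathbb{Z}[\rho]^2$. For integers $n \ge 0$ and $0 \le j < 3^n$ and a generator $\delta$ of $\mathbb{Z}/3^n$ (written multiplicatively), let $\sigma_{n,j} : \pi_1(A) \to \mathbb{Z}/3^n$ be the homomorphism with $$\sigma_{n,j}(v_1) = \sigma_{n,j}(v_2) = \delta, \qquad \sigma_{n,j}(v_3) = \sigma_{n,j}(v_4) = \delta^j,$$ and let $s_{n,j} : A_{n,j}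 = \mathbb{C}^2/\ker \sigma_{n,j} \to A$ be the corresponding covering. Let $A^*_{n,j}$ be the blowup of $A_{n,j}$ at the points of $s_{n,j}^{-1}([0,0])$, let $s^*_{n,j} : A^*_{n,j} \to A^*$ be the étale covering induced by $s_{n,j}$, and let $Y_{n,j} = (s^*_{n,j})^{-1}(Y)$. The cusps of $Y_{n,j}$ are its topological ends. Proposition 3.2. For all $n \ge 0$ and $0 \le j < 3^n$ (and every choice of $\delta$), the number of cusps of $Y_{n,j}$ is $$\begin{cases} 6 & \text{if } j \equiv 1 \pmod 3, \\ 3 + \gcd(j+1, 3^n) & \text{if } j \equiv 2 \pmod 3, \\ 3 + \gcd(j, 3^n) & \text{if } j \equiv 0 \pmod 3, \end{cases}$$ where $\gcd(0, 3^n) = 3^n$. -/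

import Mathlib

open Topology
open scoped LinearAlgebra.Projectivization

noncomputable section

/-! Topological ends. -/

/-- The (Freudenthal) ends of a topological space `X`: the inverse limit, over the compact subsets
`K` of `X` ordered by inclusion, of the sets of connected components of the complements `X ∖ K`.
An end is a compatible choice of a connected component of `X ∖ K` for every compact `K`. -/
def TopEnds (X : Type*) [TopologicalSpace X] : Type _ :=
  {e : ∀ K : TopologicalSpace.Compacts X, ConnectedComponents ((K : Set X)ᶜ : Set X) //
    ∀ (K L : TopologicalSpace.Compacts X) (h : (K : Set X) ⊆ L),
      (continuous_inclusion (Set.compl_subset_compl.mpr h)).connectedComponentsMap (e L) = e K}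

/-- The number of ends (cusps) of a space (`0` also if there are infinitely many). -/
def numEnds (X : Type*) [TopologicalSpace X] : ℕ := Nat.card (TopEnds X)

namespace HirzebruchCover

/-! The abelian surface `A = E × E`, presented as `ℂ² / π₁(A)`. -/

/-- `ζ = e^{π i / 3}`. -/
def ζ : ℂ := Complex.exp (Real.pi * Complex.I / 3)

/-- `ρ = ζ²`, a primitive cube root of unity. -/
def ρ : ℂ := ζ ^ 2

/-- The generators `v₁ = (1,0)`, `v₂ = (ρ,0)`, `v₃ = (0,1)`, `v₄ = (0,ρ)` of `π₁(A)`. -/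
def v : Fin 4 → ℂ × ℂ := ![(1, 0), (ρ, 0), (0, 1), (0, ρ)]

/-- `π₁(A)`, as the lattice `ℤ[ρ] × ℤ[ρ]` of deck transformations of `ℂ² → A`. -/
def lattice : Submodule ℤ (ℂ × ℂ) := Submodule.span ℤ (Set.range v)

theorem ζ_eq : ζ = 1 / 2 + (Real.sqrt 3 / 2 : ℝ) * Complex.I := by
  have h : (Real.pi * Complex.I / 3 : ℂ) = ((Real.pi / 3 : ℝ) : ℂ) * Complex.I := by
    push_cast; ring
  rw [ζ, h, Complex.exp_mul_I, ← Complex.ofReal_cos, ← Complex.ofReal_sin, Real.cos_pi_div_three,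
    Real.sin_pi_div_three]
  norm_num

theorem ρ_im : ρ.im = Real.sqrt 3 / 2 := by
  rw [ρ, ζ_eq, sq]; simp; ring

theorem int_add_mul_ρ_eq_zero {a b : ℤ} (h : (a : ℂ) + b * ρ = 0) : a = 0 ∧ b = 0 := by
  have hb : b = 0 := by
    have := congrArg Complex.im h
    simpa [ρ_im] using this
  subst hb
  simpa using h

theorem linearIndependent_v : LinearIndependent ℤ v := by
  rw [Fintype.linearIndependent_iff]
  intro g hg
  have h1 := int_add_mul_ρ_eq_zero (a := g 0) (b := g 1)
    (by simpa [Fin.sum_univ_four, v] using congrArg Prod.fst hg)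
  have h2 := int_add_mul_ρ_eq_zero (a := g 2) (b := g 3)
    (by simpa [Fin.sum_univ_four, v] using congrArg Prod.snd hg)
  intro i
  fin_cases i
  exacts [h1.1, h1.2, h2.1, h2.2]

/-- `π₁(A)` is `ℤ[ρ] × ℤ[ρ]`. -/
theorem mem_lattice_iff {x : ℂ × ℂ} :
    x ∈ lattice ↔ ∃ a b c d : ℤ, x = ((a : ℂ) + b * ρ, (c : ℂ) + d * ρ) := by
  rw [lattice, Submodule.mem_span_range_iff_exists_fun]
  constructor
  · rintro ⟨g, rfl⟩
    exact ⟨g 0, g 1, g 2, g 3, by ext1 <;> simp [Fin.sum_univ_four, v]⟩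
  · rintro ⟨a, b, c, d, rfl⟩
    exact ⟨![a, b, c, d], by ext1 <;> simp [Fin.sum_univ_four, v]⟩

/-- `v₁, v₂, v₃, v₄` as a `ℤ`-basis of `π₁(A)`. -/
def latticeBasis : Module.Basis (Fin 4) ℤ lattice := Module.Basis.span linearIndependent_v

/-- The homomorphism `σ_{n,j} : π₁(A) → ℤ/3ⁿ` with `v₁, v₂ ↦ δ` and `v₃, v₄ ↦ δ^j`
(written additively, `δ^j` is `j • δ`). -/
def σ (n j : ℕ) (δ : ZMod (3 ^ n)) : lattice →+ ZMod (3 ^ n) :=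
  (latticeBasis.constr ℤ ![δ, δ, j • δ, j • δ]).toAddMonoidHom

theorem σ_apply (n j : ℕ) (δ : ZMod (3 ^ n)) (i : Fin 4) :
    σ n j δ ⟨v i, Submodule.subset_span (Set.mem_range_self i)⟩ =
      (![δ, δ, j • δ, j • δ] : Fin 4 → ZMod (3 ^ n)) i := by
  have h : (⟨v i, Submodule.subset_span (Set.mem_range_self i)⟩ : lattice) = latticeBasis i :=
    Subtype.ext (Module.Basis.coe_span_apply linearIndependent_v i).symm
  rw [h]
  exact latticeBasis.constr_basis ℤ _ i

/-- `π₁(A)` acts on `ℂ²` by translations, as deck transformations of `ℂ² → A`. -/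
theorem lattice_vadd (μ : lattice) (p : ℂ × ℂ) : μ +ᵥ p = (μ : ℂ × ℂ) + p := rfl

/-- The complex torus `ℂ² / K` for `K ≤ π₁(A)`, the covering of `A` with fundamental group `K`. -/
abbrev Torus (K : AddSubgroup lattice) : Type := AddAction.orbitRel.Quotient K (ℂ × ℂ)

/-- The projection `ℂ² → ℂ² / K`. -/
def Torus.mk (K : AddSubgroup lattice) (p : ℂ × ℂ) : Torus K := Quotient.mk _ p

/-- `A = E × E = ℂ² / π₁(A)`. -/
abbrev A : Type := Torus ⊤

/-- The lines `w = 0`, `z = 0`, `w = z`, `w = ζ z` in `ℂ²` with coordinates `(z, w)`. -/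
def line : Fin 4 → Set (ℂ × ℂ) :=
  ![{p | p.2 = 0}, {p | p.1 = 0}, {p | p.2 = p.1}, {p | p.2 = ζ * p.1}]

/-- The elliptic curves `T_0, T_∞, T_1, T_ζ` in `A`. -/
def T (i : Fin 4) : Set A := Torus.mk ⊤ '' line i

/-! Blow-ups. -/

/-- The complex projective line `ℙ(ℂ²)` of lines through the origin of `ℂ²`, with its usual
topology (the quotient topology from `ℂ² ∖ {0}`). -/
instance projectiveLineTopology : TopologicalSpace (ℙ ℂ (ℂ × ℂ)) :=
  TopologicalSpace.coinduced
    (fun u : {u : ℂ × ℂ // u ≠ 0} => Projectivization.mk ℂ u.1 u.2) inferInstance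

/-- The blow-up of `ℂ²` at all points of the lattice `π₁(A)`. The blow-up of `ℂ²` at a single point
`s` is the set of `(p, ℓ) ∈ ℂ² × ℙ(ℂ²)` with `p - s ∈ ℓ`; blowing up a discrete closed set of
points is the fibre product over `ℂ²` of the blow-ups at the single points. -/
def BlowUp : Type :=
  {x : (ℂ × ℂ) × (lattice → ℙ ℂ (ℂ × ℂ)) // ∀ s : lattice, x.1 - (s : ℂ × ℂ) ∈ (x.2 s).submodule}

instance : TopologicalSpace BlowUp := instTopologicalSpaceSubtype

/-- The action of `π₁(A)` on the blow-up of `ℂ²` that lifts its action on `ℂ²` by translations. -/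
instance : AddAction lattice BlowUp where
  vadd μ x := ⟨((μ : ℂ × ℂ) + x.1.1, fun s => x.1.2 (s - μ)), fun s => by
    have h := x.2 (s - μ)
    have e : (μ : ℂ × ℂ) + x.1.1 - s = x.1.1 - ((s - μ : lattice) : ℂ × ℂ) := by
      push_cast; abel
    simpa only [e] using h⟩
  zero_vadd x := Subtype.ext (Prod.ext (zero_add _) (funext fun s => congrArg x.1.2 (sub_zero s)))
  add_vadd μ ν x := Subtype.ext (Prod.ext (add_assoc (μ : ℂ × ℂ) ν x.1.1)
    (funext fun s => congrArg x.1.2 (sub_add_eq_sub_sub s μ ν)))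

/-- The blow-up of the torus `ℂ² / K` at the points of `π₁(A) / K`, that is, at the preimage of the
origin `[0,0]` under `ℂ² / K → A`, presented as the quotient by the free and properly discontinuous action of `K` of the blow-up of `ℂ²` at
`π₁(A)`, with the quotient topology. -/
abbrev BlowUpTorus (K : AddSubgroup lattice) : Type := AddAction.orbitRel.Quotient K BlowUp

/-- The blow-down map from the blow-up of `ℂ² / K` to `ℂ² / K`. -/
def blowDown (K : AddSubgroup lattice) : BlowUpTorus K → Torus K :=
  Quotient.map' (fun x => x.1.1) (by
    rintro x y ⟨k, rfl⟩
    exact ⟨k, rfl⟩)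

/-- The covering map from the blow-up of `ℂ² / K` at the points over `[0,0]` to the blow-up
of `A` at `[0,0]`, induced by the covering `ℂ² / K → A`. -/
def covering (K : AddSubgroup lattice) : BlowUpTorus K → BlowUpTorus ⊤ :=
  Quotient.map' id (by
    rintro x y ⟨k, rfl⟩
    exact ⟨⟨(k : lattice), trivial⟩, rfl⟩)

/-! Hirzebruch's ball quotient and its coverings. -/

/-- `A*`, the blow-up of `A` at `[0,0]`. -/
abbrev AStar : Type := BlowUpTorus ⊤

/-- The proper transform of `T_0 + T_∞ + T_1 + T_ζ` in `A*`. -/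
def D : Set AStar := ⋃ i, closure (blowDown ⊤ ⁻¹' (T i \ {Torus.mk ⊤ 0}))

/-- Hirzebruch's ball quotient `Y = A* ∖ D`. -/
def Y : Set AStar := Dᶜ

/-- The étale covering `Y_{n,j}` of `Y`: the inverse image of `Y` in `A*_{n,j}`, the covering of
`A*` that belongs to the kernel of `σ_{n,j}`. -/
def Ynj (n j : ℕ) (δ : ZMod (3 ^ n)) : Set (BlowUpTorus (σ n j δ).ker) :=
  covering (σ n j δ).ker ⁻¹' Y

end HirzebruchCover

end

noncomputable section

/-! The ends of a space with a cofinal system of neighbourhoods of infinity whose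
connected pieces are indexed by a fixed type. -/

/-! The cusps of a covering are the components of the preimage of `D`: each component has a
connected punctured tubular neighbourhood, and these neighbourhoods are disjoint and shrink to
infinity. Over `T i` the components are the cosets of `K ⊔ lineLattice i` in the lattice, where `K`
is the group of the covering. So the number of cusps is a sum of four indices (`numEnds_cover`).

The geometry takes place upstairs, in the blow-up of ℂ² at all lattice points, where the curves are
proper transforms of the lines `lineForm i = b` with `b` an Eisenstein integer. Two such lines from
different families meet in a lattice point, because the determinant of their forms is a unit of
ℤ[ρ]; hence the blow-up separates them, and tubes of radius at most 1/2 around different lines are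
disjoint (`eq_of_mem_openTube`). The tubes are open (`isOpen_openTube`) and stay connected when the
proper transform is removed (`isPreconnected_puncturedTube`). The blown-up torus is compact
(`compactSpace_blowUpTorus`), so what is left outside the tubes is compact, and `numEnds_eq_card`
counts the ends.

For `K = (σ n j δ).ker` the index belonging to `T i` is that of the image of `lineLattice i` in
ℤ/3ⁿ. The images are generated by δ, by jδ, by (j+1)δ, and, for `T_ζ`, by (1+2j)δ and (1-j)δ. Their
indices are 1, gcd(j, 3ⁿ), gcd(j+1, 3ⁿ), and gcd(3, 3ⁿ) or 1 according to whether j ≡ 1 mod 3 or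
not. Exactly one of j, j+1, j-1 is divisible by 3, so at most one of the four terms differs from 1.
-/

theorem IsPreconnected.connectedComponents_mk_eq {X : Type*} [TopologicalSpace X] {s : Set X}
    (hs : IsPreconnected s) {Z : Set X} (hsZ : s ⊆ Z) {x y : X} (hx : x ∈ s) (hy : y ∈ s) :
    (ConnectedComponents.mk (⟨x, hsZ hx⟩ : Z)) = ConnectedComponents.mk ⟨y, hsZ hy⟩ := by
  rw [ConnectedComponents.coe_eq_coe']
  have h : IsPreconnected ((↑) ⁻¹' s : Set Z) := by
    rw [← IsInducing.subtypeVal.isPreconnected_image, Subtype.image_preimage_coe,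
      Set.inter_eq_right.mpr hsZ]
    exact hs
  have hy' : (⟨y, hsZ hy⟩ : Z) ∈ ((↑) ⁻¹' s : Set Z) := hy
  exact h.subset_connectedComponent hy' hx

section Ends

variable {X C : Type*} [TopologicalSpace X] {V : ℕ → C → Set X}

/-- The end of `X` determined by a decreasing sequence of connected sets that eventually leaves
every compact set. -/
def endOf (hpre : ∀ n c, IsPreconnected (V n c)) (hne : ∀ n c, (V n c).Nonempty)
    (hanti : ∀ m n c, m ≤ n → V n c ⊆ V m c)
    (hcof : ∀ K : TopologicalSpace.Compacts X, ∃ n, ∀ c, V n c ⊆ (K : Set X)ᶜ) (c : C) :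
    TopEnds X :=
  ⟨fun K => ConnectedComponents.mk
      ⟨(hne (hcof K).choose c).some, (hcof K).choose_spec c (hne _ c).some_mem⟩, by
    intro K L h
    set m := (hcof K).choose
    set n := (hcof L).choose
    have hm := (hcof K).choose_spec c
    have hn := (hcof L).choose_spec c
    change ConnectedComponents.mk (⟨(hne n c).some, _⟩ : ((K : Set X)ᶜ : Set X)) = _
    rcases le_total m n with hmn | hmn
    · exact (hpre m c).connectedComponents_mk_eq hm (hanti _ _ c hmn (hne n c).some_mem)
        (hne m c).some_mem
    · exact (hpre n c).connectedComponents_mk_eq (hn.trans (Set.compl_subset_compl.mpr h))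
        (hne n c).some_mem (hanti _ _ c hmn (hne m c).some_mem)⟩

/-- The level and the point chosen in `endOf` are immaterial: of two levels one contains the other,
and the larger one is connected and avoids `K`. -/
theorem endOf_val_eq (hpre : ∀ n c, IsPreconnected (V n c)) (hne : ∀ n c, (V n c).Nonempty)
    (hanti : ∀ m n c, m ≤ n → V n c ⊆ V m c)
    (hcof : ∀ K : TopologicalSpace.Compacts X, ∃ n, ∀ c, V n c ⊆ (K : Set X)ᶜ) (c : C)
    (K : TopologicalSpace.Compacts X) {n : ℕ} (hn : V n c ⊆ (K : Set X)ᶜ) {x : X}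
    (hx : x ∈ V n c) :
    (endOf hpre hne hanti hcof c).1 K = ConnectedComponents.mk ⟨x, hn hx⟩ := by
  set m := (hcof K).choose with hm0
  have hm := (hcof K).choose_spec c
  change ConnectedComponents.mk (⟨(hne m c).some, _⟩ : ((K : Set X)ᶜ : Set X)) = _
  rcases le_total m n with hmn | hmn
  · exact (hpre m c).connectedComponents_mk_eq hm (hne m c).some_mem (hanti _ _ c hmn hx)
  · exact (hpre n c).connectedComponents_mk_eq hn (hanti _ _ c hmn (hne m c).some_mem) hx

/-- Outside the compact set `Kn n` the pieces `V n c` are open, disjoint and exhaustive, hence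
clopen. An end therefore selects one piece at each level, and comparison with level 0 shows that its
index does not depend on the level. -/
theorem numEnds_eq_card (hopen : ∀ n c, IsOpen (V n c)) (hpre : ∀ n c, IsPreconnected (V n c))
    (hne : ∀ n c, (V n c).Nonempty) (hdisj : ∀ n c d x, x ∈ V n c → x ∈ V n d → c = d)
    (hanti : ∀ m n c, m ≤ n → V n c ⊆ V m c) (hcpt : ∀ n, IsCompact (⋃ c, V n c)ᶜ)
    (hcof : ∀ K : Set X, IsCompact K → ∃ n, ∀ c, V n c ⊆ Kᶜ) :
    numEnds X = Nat.card C := by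
  have hcof' : ∀ K : TopologicalSpace.Compacts X, ∃ n, ∀ c, V n c ⊆ (K : Set X)ᶜ :=
    fun K => hcof K K.isCompact
  let Kn : ℕ → TopologicalSpace.Compacts X := fun n => ⟨(⋃ c, V n c)ᶜ, hcpt n⟩
  have hKn : ∀ n c, V n c ⊆ (Kn n : Set X)ᶜ := fun n c x hx => by
    simpa [Kn] using ⟨c, hx⟩
  have hclopen : ∀ n c, IsClopen ((↑) ⁻¹' V n c : Set ((Kn n : Set X)ᶜ : Set X)) := by
    intro n c
    refine ⟨⟨?_⟩, (hopen n c).preimage continuous_subtype_val⟩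
    have : ((↑) ⁻¹' V n c : Set ((Kn n : Set X)ᶜ : Set X))ᶜ
        = (↑) ⁻¹' ⋃ d : {d // d ≠ c}, V n d := by
      ext ⟨x, hx⟩
      have hx' : ∃ d, x ∈ V n d := by simpa [Kn] using hx
      obtain ⟨d, hd⟩ := hx'
      simp only [Set.mem_compl_iff, Set.mem_preimage, Set.mem_iUnion, Subtype.exists]
      constructor
      · intro h
        exact ⟨d, fun e => h (e ▸ hd), hd⟩
      · rintro ⟨d', hd', hxd'⟩ h
        exact hd' (hdisj n _ _ x hxd' h)
    rw [this]
    exact (isOpen_iUnion fun d : {d // d ≠ c} => hopen n d).preimage continuous_subtype_val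
  have hsep : ∀ n c d x y (hx : x ∈ V n c) (hy : y ∈ V n d),
      (ConnectedComponents.mk (⟨x, hKn n c hx⟩ : ((Kn n : Set X)ᶜ : Set X)))
        = ConnectedComponents.mk ⟨y, hKn n d hy⟩ → c = d := by
    intro n c d x y hx hy h
    rw [ConnectedComponents.coe_eq_coe'] at h
    have := (hclopen n d).connectedComponent_subset (x := ⟨y, hKn n d hy⟩) hy h
    exact hdisj n c d x hx this
  symm
  refine Nat.card_congr (Equiv.ofBijective (endOf hpre hne hanti hcof') ⟨?_, ?_⟩)
  · intro c d h
    have := congrArg (fun e : TopEnds X => e.1 (Kn 0)) h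
    rw [endOf_val_eq hpre hne hanti hcof' c (Kn 0) (hKn 0 c) (hne 0 c).some_mem,
      endOf_val_eq hpre hne hanti hcof' d (Kn 0) (hKn 0 d) (hne 0 d).some_mem] at this
    exact hsep 0 c d _ _ (hne 0 c).some_mem (hne 0 d).some_mem this
  · intro e
    have key : ∀ n, ∃ c, ∃ x, ∃ hx : x ∈ V n c, e.1 (Kn n) = ConnectedComponents.mk
        ⟨x, hKn n c hx⟩ := by
      intro n
      obtain ⟨⟨x, hx⟩, hxe⟩ := ConnectedComponents.surjective_coe (e.1 (Kn n))
      have hx' : ∃ d, x ∈ V n d := by simpa [Kn] using hx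
      obtain ⟨d, hd⟩ := hx'
      exact ⟨d, x, hd, hxe.symm⟩
    obtain ⟨c, x, hx, hxe⟩ := key 0
    refine ⟨c, Subtype.ext (funext fun K => ?_)⟩
    obtain ⟨n, hn⟩ := hcof' K
    obtain ⟨d, y, hy, hye⟩ := key n
    have h0 : (Kn 0 : Set X) ⊆ Kn n := by
      simp only [Kn, TopologicalSpace.Compacts.coe_mk, Set.compl_subset_compl]
      exact Set.iUnion_mono fun d => hanti 0 n d n.zero_le
    have hd : c = d := by
      have h1 := e.2 (Kn 0) (Kn n) h0
      rw [hye, hxe] at h1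
      exact hsep 0 c d x y hx (hanti 0 n d n.zero_le hy) h1.symm
    subst hd
    rw [endOf_val_eq hpre hne hanti hcof' c K (hn c) hy]
    have hK : (K : Set X) ⊆ Kn n := by
      intro z hz
      simp only [Kn, TopologicalSpace.Compacts.coe_mk, Set.mem_compl_iff, Set.mem_iUnion]
      rintro ⟨d, hd⟩
      exact hn d hd hz
    rw [← e.2 K (Kn n) hK, hye]
    rfl

end Ends

namespace HirzebruchCover

/-! The Eisenstein integers. -/

theorem ζ_eq_one_add_ρ : ζ = 1 + ρ := by
  have h3 : ((Real.sqrt 3 : ℝ) : ℂ) ^ 2 = 3 := by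
    rw [← Complex.ofReal_pow, Real.sq_sqrt (by norm_num)]; norm_num
  rw [ρ, ζ_eq]
  push_cast
  ring_nf
  rw [h3, Complex.I_sq]
  ring

theorem ρ_sq : ρ ^ 2 = -1 - ρ := by
  have h : ρ = ζ ^ 2 := rfl
  have h2 := ζ_eq_one_add_ρ
  rw [h2] at h
  linear_combination -h

theorem ρ_re : ρ.re = -1 / 2 := by
  have h := congrArg Complex.re ζ_eq_one_add_ρ
  rw [ζ_eq] at h
  simp at h
  linarith

/-- The ring `ℤ[ρ]` of Eisenstein integers. -/
def eisenstein : Subring ℂ where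
  carrier := {x | ∃ a b : ℤ, x = a + b * ρ}
  mul_mem' := by
    rintro _ _ ⟨a, b, rfl⟩ ⟨c, d, rfl⟩
    refine ⟨a * c - b * d, a * d + b * c - b * d, ?_⟩
    push_cast
    linear_combination ((b : ℂ) * d) * ρ_sq
  one_mem' := ⟨1, 0, by simp⟩
  add_mem' := by
    rintro _ _ ⟨a, b, rfl⟩ ⟨c, d, rfl⟩
    exact ⟨a + c, b + d, by push_cast; ring⟩
  zero_mem' := ⟨0, 0, by simp⟩
  neg_mem' := by
    rintro _ ⟨a, b, rfl⟩
    exact ⟨-a, -b, by push_cast; ring⟩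

theorem mem_eisenstein {x : ℂ} : x ∈ eisenstein ↔ ∃ a b : ℤ, x = a + b * ρ := Iff.rfl

theorem ρ_mem : ρ ∈ eisenstein := ⟨0, 1, by simp⟩

theorem ζ_mem : ζ ∈ eisenstein := ⟨1, 1, by simp [ζ_eq_one_add_ρ]⟩

theorem mem_lattice {x : ℂ × ℂ} : x ∈ lattice ↔ x.1 ∈ eisenstein ∧ x.2 ∈ eisenstein := by
  rw [mem_lattice_iff]
  constructor
  · rintro ⟨a, b, c, d, rfl⟩
    exact ⟨⟨a, b, rfl⟩, ⟨c, d, rfl⟩⟩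
  · rintro ⟨⟨a, b, h⟩, ⟨c, d, h'⟩⟩
    exact ⟨a, b, c, d, Prod.ext h h'⟩

theorem normSq_add_mul_ρ (x y : ℝ) :
    Complex.normSq ((x : ℂ) + y * ρ) = x ^ 2 - x * y + y ^ 2 := by
  have h3 : Real.sqrt 3 ^ 2 = 3 := Real.sq_sqrt (by norm_num)
  rw [Complex.normSq_apply]
  simp [ρ_re, ρ_im]
  linear_combination (y ^ 2 / 4) * h3

theorem norm_ρ : ‖ρ‖ = 1 := by
  have h := normSq_add_mul_ρ 0 1
  rw [Complex.normSq_eq_norm_sq] at h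
  simp at h
  exact h.resolve_right fun h' => by linarith [norm_nonneg ρ]

theorem norm_ζ : ‖ζ‖ = 1 := by
  have h := norm_ρ
  rw [ρ, norm_pow] at h
  exact (pow_eq_one_iff_of_nonneg (norm_nonneg _) two_ne_zero).mp h

/-- The squared norm a² - ab + b² is a positive integer. -/
theorem one_le_norm {x : ℂ} (hx : x ∈ eisenstein) (h0 : x ≠ 0) : 1 ≤ ‖x‖ := by
  obtain ⟨a, b, rfl⟩ := hx
  have h := normSq_add_mul_ρ a b
  rw [Complex.normSq_eq_norm_sq] at h
  push_cast at h
  have hpos : 0 < ‖(a : ℂ) + b * ρ‖ := norm_pos_iff.mpr h0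
  have h2 : (0 : ℝ) < ((a ^ 2 - a * b + b ^ 2 : ℤ) : ℝ) := by
    push_cast
    rw [← h]; positivity
  have h3 : (1 : ℤ) ≤ a ^ 2 - a * b + b ^ 2 := by exact_mod_cast h2
  have h4 : (1 : ℝ) ≤ (a : ℝ) ^ 2 - a * b + b ^ 2 := by exact_mod_cast h3
  nlinarith

instance : DiscreteTopology eisenstein := by
  refine DiscreteTopology.of_forall_le_dist (r := 1) one_pos ?_
  intro x y hxy
  rw [Subtype.dist_eq, dist_eq_norm]
  exact one_le_norm (eisenstein.sub_mem x.2 y.2) (sub_ne_zero.mpr fun h => hxy (Subtype.ext h))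

theorem isClosed_eisenstein : IsClosed (eisenstein : Set ℂ) := by
  have hd : DiscreteTopology eisenstein.toAddSubgroup :=
    inferInstanceAs (DiscreteTopology eisenstein)
  exact AddSubgroup.isClosed_of_discrete (H := eisenstein.toAddSubgroup)

theorem finite_eisenstein_inter_closedBall (z : ℂ) (r : ℝ) :
    {x : ℂ | x ∈ eisenstein ∧ ‖x - z‖ ≤ r}.Finite := by
  have hd : IsDiscrete (eisenstein : Set ℂ) := ⟨inferInstanceAs (DiscreteTopology eisenstein)⟩
  refine (Metric.finite_isBounded_inter_isClosed hd
    (Metric.isBounded_closedBall (x := z) (r := r)) isClosed_eisenstein).subset ?_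
  rintro x ⟨hx, hxz⟩
  exact ⟨by simpa [dist_eq_norm] using hxz, hx⟩

theorem locallyFinite_closedBall_eisenstein (r : ℝ) :
    LocallyFinite fun a : eisenstein => Metric.closedBall (a : ℂ) r := by
  intro z
  refine ⟨Metric.ball z 1, Metric.ball_mem_nhds z one_pos, ?_⟩
  have h := (finite_eisenstein_inter_closedBall z (r + 1)).preimage
    (f := ((↑) : eisenstein → ℂ)) Subtype.val_injective.injOn
  refine h.subset ?_
  rintro a ⟨y, hy, hyz⟩
  refine ⟨a.2, ?_⟩
  rw [← dist_eq_norm]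
  have h1 : dist y a ≤ r := hy
  have h2 : dist y z < 1 := hyz
  have := dist_triangle_left (a : ℂ) z y
  linarith

theorem exists_eisenstein_norm_sub_le (z : ℂ) : ∃ a ∈ eisenstein, ‖z - a‖ ≤ 2 := by
  obtain ⟨y, hy⟩ : ∃ y : ℝ, y * (Real.sqrt 3 / 2) = z.im :=
    ⟨z.im / (Real.sqrt 3 / 2), div_mul_cancel₀ _ (by positivity)⟩
  obtain ⟨x, hx⟩ : ∃ x : ℝ, x = z.re + y / 2 := ⟨_, rfl⟩
  have hz : z = x + y * ρ := by
    apply Complex.ext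
    · simp [ρ_re, hx]; ring
    · simp [ρ_im, hy]
  refine ⟨(⌊x⌋ : ℤ) + (⌊y⌋ : ℤ) * ρ, ⟨_, _, rfl⟩, ?_⟩
  have h : z - ((⌊x⌋ : ℤ) + (⌊y⌋ : ℤ) * ρ) = ((Int.fract x : ℝ) : ℂ) + ((Int.fract y : ℝ) : ℂ) * ρ := by
    rw [← Int.self_sub_floor x, ← Int.self_sub_floor y]
    nth_rw 1 [hz]
    push_cast
    ring
  rw [h]
  refine (norm_add_le _ _).trans ?_
  rw [norm_mul, norm_ρ, Complex.norm_of_nonneg (Int.fract_nonneg x),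
    Complex.norm_of_nonneg (Int.fract_nonneg y)]
  linarith [Int.fract_lt_one x, Int.fract_lt_one y]

/-! Coordinates adapted to the four families of lines. -/

/-- A linear form whose zero set is the line `line i`. -/
def lineForm : Fin 4 → (ℂ × ℂ →L[ℂ] ℂ) :=
  ![.snd ℂ ℂ ℂ, .fst ℂ ℂ ℂ, .snd ℂ ℂ ℂ - .fst ℂ ℂ ℂ, .snd ℂ ℂ ℂ - ζ • .fst ℂ ℂ ℂ]

/-- A linear form that restricts to a coordinate on the line `line i`. -/
def coordForm : Fin 4 → (ℂ × ℂ →L[ℂ] ℂ) :=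
  ![.fst ℂ ℂ ℂ, .snd ℂ ℂ ℂ, .fst ℂ ℂ ℂ, .fst ℂ ℂ ℂ]

/-- The point with coordinates `(coordForm i, lineForm i) = (a, b)`. -/
def ofCoords (i : Fin 4) (a b : ℂ) : ℂ × ℂ :=
  (![(a, b), (b, a), (a, b + a), (a, b + ζ * a)] : Fin 4 → ℂ × ℂ) i

theorem mem_line_iff (i : Fin 4) (p : ℂ × ℂ) : p ∈ line i ↔ lineForm i p = 0 := by
  fin_cases i <;> simp [line, lineForm, sub_eq_zero]

@[simp] theorem lineForm_ofCoords (i : Fin 4) (a b : ℂ) : lineForm i (ofCoords i a b) = b := by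
  fin_cases i <;> simp [lineForm, ofCoords]

@[simp] theorem coordForm_ofCoords (i : Fin 4) (a b : ℂ) : coordForm i (ofCoords i a b) = a := by
  fin_cases i <;> simp [coordForm, ofCoords]

theorem ofCoords_forms (i : Fin 4) (p : ℂ × ℂ) :
    ofCoords i (coordForm i p) (lineForm i p) = p := by
  fin_cases i <;> simp [coordForm, lineForm, ofCoords]

theorem eq_of_forms_eq (i : Fin 4) {p q : ℂ × ℂ} (h : coordForm i p = coordForm i q)
    (h' : lineForm i p = lineForm i q) : p = q := by
  rw [← ofCoords_forms i p, h, h', ofCoords_forms]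

theorem continuous_ofCoords (i : Fin 4) : Continuous fun q : ℂ × ℂ => ofCoords i q.1 q.2 := by
  fin_cases i <;> simp only [ofCoords, Fin.zero_eta, Fin.mk_one, Matrix.cons_val] <;> fun_prop

theorem ofCoords_mem_lattice (i : Fin 4) {a b : ℂ} (ha : a ∈ eisenstein) (hb : b ∈ eisenstein) :
    ofCoords i a b ∈ lattice := by
  have h := eisenstein.add_mem hb ha
  have h' := eisenstein.add_mem hb (eisenstein.mul_mem ζ_mem ha)
  rw [mem_lattice]
  fin_cases i <;> simp [ofCoords, *]

theorem lineForm_mem (i : Fin 4) {s : ℂ × ℂ} (hs : s ∈ lattice) : lineForm i s ∈ eisenstein := by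
  rw [mem_lattice] at hs
  have h := eisenstein.sub_mem hs.2 hs.1
  have h' := eisenstein.sub_mem hs.2 (eisenstein.mul_mem ζ_mem hs.1)
  fin_cases i <;> simp [lineForm, *]

theorem coordForm_mem (i : Fin 4) {s : ℂ × ℂ} (hs : s ∈ lattice) :
    coordForm i s ∈ eisenstein := by
  rw [mem_lattice] at hs
  fin_cases i <;> simp [coordForm, *]

/-- Two lines of different families meet in a lattice point if both contain lattice points. -/
theorem exists_mem_lattice_of_ne {i j : Fin 4} (hij : i ≠ j) {b c : ℂ} (hb : b ∈ eisenstein)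
    (hc : c ∈ eisenstein) : ∃ s ∈ lattice, lineForm i s = b ∧ lineForm j s = c := by
  wlog hlt : i < j generalizing i j b c
  · obtain ⟨s, hs, h, h'⟩ := this hij.symm hc hb (lt_of_le_of_ne (not_lt.mp hlt) hij.symm)
    exact ⟨s, hs, h', h⟩
  have h₁ := eisenstein.sub_mem hb hc
  -- The factors -ρ = 1/ζ and ρ² = 1/(ζ - 1) invert the only determinants, up to sign, that are not
  -- ±1.
  have h₂ := eisenstein.mul_mem (eisenstein.neg_mem ρ_mem) h₁
  have h₃ := eisenstein.mul_mem (eisenstein.pow_mem ρ_mem 2) h₁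
  have h₄ := eisenstein.mul_mem ζ_mem hb
  fin_cases i <;> fin_cases j <;> first
    | exact absurd hlt (by decide)
    | skip
  · exact ⟨(c, b), mem_lattice.mpr ⟨hc, hb⟩, by simp [lineForm]⟩
  · exact ⟨(b - c, b), mem_lattice.mpr ⟨h₁, hb⟩, by simp [lineForm]⟩
  · refine ⟨(-ρ * (b - c), b), mem_lattice.mpr ⟨h₂, hb⟩, by simp [lineForm], ?_⟩
    simp only [lineForm, ζ_eq_one_add_ρ]
    simp
    linear_combination (b - c) * ρ_sq
  · exact ⟨(b, c + b), mem_lattice.mpr ⟨hb, eisenstein.add_mem hc hb⟩, by simp [lineForm]⟩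
  · exact ⟨(b, c + ζ * b), mem_lattice.mpr ⟨hb, eisenstein.add_mem hc h₄⟩, by simp [lineForm]⟩
  · refine ⟨(ρ ^ 2 * (b - c), b + ρ ^ 2 * (b - c)),
      mem_lattice.mpr ⟨h₃, eisenstein.add_mem hb h₃⟩, by simp [lineForm], ?_⟩
    simp only [lineForm, ζ_eq_one_add_ρ]
    simp
    linear_combination (-(b - c) * (ρ - 1)) * ρ_sq

/-- The lines `line i` have different directions. -/
theorem norm_coordForm_le_of_ne {i j : Fin 4} (hij : i ≠ j) (v : ℂ × ℂ) :
    ‖coordForm i v‖ ≤ ‖lineForm i v‖ + ‖lineForm j v‖ := by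
  obtain ⟨z, w⟩ := v
  have h0 := norm_nonneg w
  have h1 := norm_nonneg (w - z)
  have h2 := norm_nonneg (w - ζ * z)
  have hζ : ‖ζ * z‖ = ‖z‖ := by rw [norm_mul, norm_ζ, one_mul]
  have h3 : ‖z‖ ≤ ‖w‖ + ‖w - z‖ := by
    simpa using norm_sub_le w (w - z)
  have h4 : ‖z‖ ≤ ‖w‖ + ‖w - ζ * z‖ := by
    rw [← hζ]; simpa using norm_sub_le w (w - ζ * z)
  have h5 : ‖w‖ ≤ ‖w - z‖ + ‖z‖ := by
    simpa using norm_add_le (w - z) z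
  have h6 : ‖w‖ ≤ ‖w - ζ * z‖ + ‖z‖ := by
    rw [← hζ]; simpa using norm_add_le (w - ζ * z) (ζ * z)
  have h7 : ‖z‖ ≤ ‖w - z‖ + ‖w - ζ * z‖ := by
    have hρ : ‖ρ * z‖ = ‖z‖ := by rw [norm_mul, norm_ρ, one_mul]
    have e : ρ * z = (w - z) - (w - ζ * z) := by rw [ζ_eq_one_add_ρ]; ring
    rw [← hρ, e]
    exact norm_sub_le _ _
  fin_cases i <;> fin_cases j <;> first
    | exact absurd rfl hij
    | simp [coordForm, lineForm]
  all_goals linarith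

/-! The topology of the projective line. -/

/-- The quotient map from `ℂ² ∖ {0}` to the projective line. -/
def projMk (u : {u : ℂ × ℂ // u ≠ 0}) : ℙ ℂ (ℂ × ℂ) := Projectivization.mk ℂ u.1 u.2

theorem isQuotientMap_projMk : IsQuotientMap projMk :=
  ⟨⟨rfl⟩, fun ℓ => ⟨⟨ℓ.rep, ℓ.rep_nonzero⟩, ℓ.mk_rep⟩⟩

/-- The saturation of an open set is the union of its multiples by units. Openness, unlike being a
quotient map, survives products, which `isClosed_incidence` needs. -/
theorem isOpenMap_projMk : IsOpenMap projMk := by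
  intro U hU
  rw [← isQuotientMap_projMk.isOpen_preimage]
  have : projMk ⁻¹' (projMk '' U) = ⋃ a : ℂˣ,
      (fun u : {u : ℂ × ℂ // u ≠ 0} => (⟨(a : ℂ) • u.1, smul_ne_zero a.ne_zero u.2⟩ :
        {u : ℂ × ℂ // u ≠ 0})) ⁻¹' U := by
    ext u
    simp only [Set.mem_preimage, Set.mem_image, Set.mem_iUnion, projMk,
      Projectivization.mk_eq_mk_iff]
    constructor
    · rintro ⟨w, hw, a, ha⟩
      exact ⟨a, by convert hw using 1; exact Subtype.ext ha⟩
    · rintro ⟨a, ha⟩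
      exact ⟨_, ha, a, rfl⟩
  rw [this]
  refine isOpen_iUnion fun a => hU.preimage ?_
  exact (continuous_subtype_val.const_smul (a : ℂ)).subtype_mk _

theorem continuous_projMk : Continuous projMk := isQuotientMap_projMk.continuous

instance : CompactSpace (ℙ ℂ (ℂ × ℂ)) := by
  have hc : CompactSpace (Metric.sphere (0 : ℂ × ℂ) 1) := inferInstance
  let f : Metric.sphere (0 : ℂ × ℂ) 1 → ℙ ℂ (ℂ × ℂ) := fun u =>
    projMk ⟨u.1, fun h => by have := u.2; simp [h] at this⟩
  have hf : Continuous f := continuous_projMk.comp (continuous_subtype_val.subtype_mk _)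
  have hs : Function.Surjective f := by
    intro ℓ
    induction ℓ using Projectivization.ind with
    | h v hv =>
      have hv' : (‖v‖ : ℂ) ≠ 0 := by simpa using hv
      refine ⟨⟨(‖v‖ : ℂ)⁻¹ • v, ?_⟩, ?_⟩
      · rw [mem_sphere_zero_iff_norm, norm_smul, norm_inv, Complex.norm_real, norm_norm,
          inv_mul_cancel₀ (by simpa using hv)]
      · exact (Projectivization.mk_eq_mk_iff' ℂ _ _ _ _).mpr ⟨(‖v‖ : ℂ)⁻¹, rfl⟩
  exact hs.compactSpace hf

theorem mem_submodule_projMk {u : {u : ℂ × ℂ // u ≠ 0}} {p : ℂ × ℂ} :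
    p ∈ (projMk u).submodule ↔ ∃ a : ℂ, a • u.1 = p := by
  rw [projMk, Projectivization.submodule_mk, Submodule.mem_span_singleton]

theorem isClosed_incidence : IsClosed {x : (ℂ × ℂ) × ℙ ℂ (ℂ × ℂ) | x.1 ∈ x.2.submodule} := by
  have hq : IsQuotientMap (Prod.map (id : ℂ × ℂ → ℂ × ℂ) projMk) :=
    (IsOpenMap.id.prodMap isOpenMap_projMk).isQuotientMap
      (continuous_id.prodMap continuous_projMk)
      (Function.surjective_id.prodMap isQuotientMap_projMk.surjective)
  rw [← hq.isClosed_preimage]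
  have : Prod.map (id : ℂ × ℂ → ℂ × ℂ) projMk ⁻¹' {x | x.1 ∈ x.2.submodule} =
      {x | x.1.1 * x.2.1.2 = x.1.2 * x.2.1.1} := by
    ext ⟨⟨p, q⟩, ⟨⟨z, w⟩, h⟩⟩
    simp only [Set.mem_preimage, Prod.map_apply, id, Set.mem_ofPred_eq, mem_submodule_projMk,
      Prod.smul_mk, Prod.mk.injEq, smul_eq_mul]
    constructor
    · rintro ⟨a, rfl, rfl⟩
      ring
    · intro e
      by_cases hz : z = 0
      · have hw : w ≠ 0 := fun hw => h (by simp [hz, hw])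
        refine ⟨q / w, ?_, by field_simp⟩
        subst hz
        simp [hw] at e
        simp [e]
      · refine ⟨p / z, by field_simp, ?_⟩
        field_simp
        linear_combination e
  rw [this]
  exact isClosed_eq (by fun_prop) (by fun_prop)

theorem submodule_eq_of_mem {ℓ : ℙ ℂ (ℂ × ℂ)} {v : ℂ × ℂ} (hv : v ≠ 0) (h : v ∈ ℓ.submodule) :
    ℓ = Projectivization.mk ℂ v hv := by
  induction ℓ using Projectivization.ind with
  | h w hw =>
    rw [Projectivization.submodule_mk, Submodule.mem_span_singleton] at h
    obtain ⟨a, ha⟩ := h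
    symm
    exact (Projectivization.mk_eq_mk_iff' ℂ _ _ _ _).mpr ⟨a, ha⟩

theorem exists_ne_zero_mem (ℓ : ℙ ℂ (ℂ × ℂ)) : ∃ v ∈ ℓ.submodule, v ≠ 0 := by
  refine ⟨ℓ.rep, ?_, ℓ.rep_nonzero⟩
  rw [Projectivization.submodule_eq]
  exact Submodule.mem_span_singleton_self _

/-- The inequality is homogeneous, so one spanning vector decides it, and it is a closed condition
on that vector. -/
theorem isClosed_slope_le (i : Fin 4) (ε : ℝ) :
    IsClosed {ℓ : ℙ ℂ (ℂ × ℂ) | ∀ v ∈ ℓ.submodule, ‖lineForm i v‖ ≤ ε * ‖coordForm i v‖} := by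
  rw [← isQuotientMap_projMk.isClosed_preimage]
  have : projMk ⁻¹' {ℓ | ∀ v ∈ ℓ.submodule, ‖lineForm i v‖ ≤ ε * ‖coordForm i v‖} =
      {u | ‖lineForm i u.1‖ ≤ ε * ‖coordForm i u.1‖} := by
    ext u
    simp only [Set.mem_preimage, Set.mem_ofPred_eq, mem_submodule_projMk]
    constructor
    · exact fun h => h _ ⟨1, one_smul _ _⟩
    · rintro h _ ⟨a, rfl⟩
      rw [map_smul, map_smul, norm_smul, norm_smul, mul_left_comm]
      exact mul_le_mul_of_nonneg_left h (norm_nonneg a)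
  rw [this]
  exact isClosed_le (by fun_prop) (by fun_prop)

theorem isClosed_le_slope (i : Fin 4) (ε : ℝ) :
    IsClosed {ℓ : ℙ ℂ (ℂ × ℂ) | ∀ v ∈ ℓ.submodule, ε * ‖coordForm i v‖ ≤ ‖lineForm i v‖} := by
  rw [← isQuotientMap_projMk.isClosed_preimage]
  have : projMk ⁻¹' {ℓ | ∀ v ∈ ℓ.submodule, ε * ‖coordForm i v‖ ≤ ‖lineForm i v‖} =
      {u | ε * ‖coordForm i u.1‖ ≤ ‖lineForm i u.1‖} := by
    ext u
    simp only [Set.mem_preimage, Set.mem_ofPred_eq, mem_submodule_projMk]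
    constructor
    · exact fun h => h _ ⟨1, one_smul _ _⟩
    · rintro h _ ⟨a, rfl⟩
      rw [map_smul, map_smul, norm_smul, norm_smul, mul_left_comm]
      exact mul_le_mul_of_nonneg_left h (norm_nonneg a)
  rw [this]
  exact isClosed_le (by fun_prop) (by fun_prop)

/-! The topology of the blow-up. -/

/-- The inclusion of the blow-up into the product that contains it. -/
def BlowUp.toProd (x : BlowUp) : (ℂ × ℂ) × (lattice → ℙ ℂ (ℂ × ℂ)) := x.1

theorem BlowUp.isClosedEmbedding_toProd : IsClosedEmbedding BlowUp.toProd := by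
  refine IsClosed.isClosedEmbedding_subtypeVal
    (s := {x : (ℂ × ℂ) × (lattice → ℙ ℂ (ℂ × ℂ)) |
      ∀ s : lattice, x.1 - (s : ℂ × ℂ) ∈ (x.2 s).submodule}) ?_
  rw [Set.ofPred_forall]
  refine isClosed_iInter fun s => ?_
  exact isClosed_incidence.preimage (f := fun x : (ℂ × ℂ) × (lattice → ℙ ℂ (ℂ × ℂ)) =>
    (x.1 - (s : ℂ × ℂ), x.2 s)) (by fun_prop)

theorem continuous_point : Continuous fun x : BlowUp => x.1.1 :=
  continuous_fst.comp continuous_subtype_val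

theorem continuous_direction (s : lattice) : Continuous fun x : BlowUp => x.1.2 s :=
  (continuous_apply s).comp (continuous_snd.comp continuous_subtype_val)

/-- The blow-down is proper: the directions range over a product of compact projective lines, in
which the blow-up is cut out by closed conditions. -/
theorem isCompact_point_preimage {B : Set (ℂ × ℂ)} (hB : IsCompact B) :
    IsCompact {x : BlowUp | x.1.1 ∈ B} := by
  have h := BlowUp.isClosedEmbedding_toProd.isCompact_preimage
    (hB.prod (isCompact_univ (X := lattice → ℙ ℂ (ℂ × ℂ))))
  have e : {x : BlowUp | x.1.1 ∈ B} = BlowUp.toProd ⁻¹' (B ×ˢ Set.univ) :=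
    Set.ext fun x => (and_iff_left (Set.mem_univ _)).symm
  rwa [e]

theorem vadd_point (μ : lattice) (x : BlowUp) : (μ +ᵥ x).1.1 = μ + x.1.1 := rfl

theorem vadd_direction (μ s : lattice) (x : BlowUp) : (μ +ᵥ x).1.2 s = x.1.2 (s - μ) := rfl

instance : ContinuousConstVAdd lattice BlowUp where
  continuous_const_vadd μ := by
    refine Continuous.subtype_mk ?_ _
    exact (continuous_const.add continuous_point).prodMk
      (continuous_pi fun s => continuous_direction (s - μ))

instance (K : AddSubgroup lattice) : ContinuousConstVAdd K BlowUp where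
  continuous_const_vadd μ := continuous_const_vadd (μ : lattice)

open Classical in
/-- The point of the blow-up over `p`, where the directions that `p` does not determine are those
of a given point. -/
def liftPoint (x : BlowUp) (p : ℂ × ℂ) : BlowUp :=
  ⟨(p, fun s => if h : p - s ≠ 0 then Projectivization.mk ℂ _ h else x.1.2 s), fun s => by
    by_cases h : p - s ≠ 0
    · simp only [dif_pos h]
      rw [Projectivization.submodule_mk]
      exact Submodule.mem_span_singleton_self _
    · simp only [dif_neg h]
      rw [not_not.mp h]
      exact Submodule.zero_mem _⟩

@[simp] theorem liftPoint_point (x : BlowUp) (p : ℂ × ℂ) : (liftPoint x p).1.1 = p := rfl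

theorem liftPoint_direction (x : BlowUp) {p : ℂ × ℂ} {s : lattice} (h : p - s ≠ 0) :
    (liftPoint x p).1.2 s = Projectivization.mk ℂ _ h := dif_pos h

theorem direction_eq (x : BlowUp) {s : lattice} (h : x.1.1 - s ≠ 0) :
    x.1.2 s = Projectivization.mk ℂ _ h := submodule_eq_of_mem h (x.2 s)

theorem eq_of_point_eq {x y : BlowUp} (h : x.1.1 = y.1.1) (hx : x.1.1 ∉ lattice) : x = y := by
  refine Subtype.ext (Prod.ext h (funext fun s => ?_))
  have h1 : x.1.1 - s ≠ 0 := fun e => hx (by rw [sub_eq_zero.mp e]; exact s.2)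
  rw [direction_eq x h1, direction_eq y (by rwa [← h])]
  simp only [h]

theorem continuousAt_direction (p₀ : ℂ × ℂ) {s : ℂ × ℂ} (h : p₀ - s ≠ 0) {f : ℂ × ℂ → ℙ ℂ (ℂ × ℂ)}
    (hf : ∀ p, ∀ h : p - s ≠ 0, f p = Projectivization.mk ℂ _ h) : ContinuousAt f p₀ := by
  have ho : IsOpen {p : ℂ × ℂ | p - s ≠ 0} := isOpen_ne_fun (by fun_prop) continuous_const
  rw [← ho.isOpenEmbedding_subtypeVal.continuousAt_iff (x := ⟨p₀, h⟩)]
  have : f ∘ ((↑) : {p : ℂ × ℂ | p - s ≠ 0} → ℂ × ℂ) =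
      projMk ∘ fun p : {p : ℂ × ℂ | p - s ≠ 0} => ⟨p.1 - s, p.2⟩ := by
    ext1 p
    exact hf p.1 p.2
  rw [this]
  exact (continuous_projMk.comp
    ((continuous_subtype_val.sub continuous_const).subtype_mk _)).continuousAt

theorem continuousAt_liftPoint (x : BlowUp) {p : ℂ × ℂ} (hp : p ∉ lattice) :
    ContinuousAt (liftPoint x) p := by
  rw [BlowUp.isClosedEmbedding_toProd.isInducing.continuousAt_iff]
  refine continuousAt_id.prodMk (continuousAt_pi.mpr fun s => ?_)
  refine continuousAt_direction p (s := s) (fun e => hp ?_) fun q hq => liftPoint_direction x hq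
  rw [sub_eq_zero.mp e]
  exact s.2

/-- Approaching a point of the blow-up along a line in `ℂ²`. -/
theorem tendsto_liftPoint (x : BlowUp) {d : ℂ × ℂ} (hd : d ≠ 0)
    (h : ∀ s : lattice, x.1.1 = s → d ∈ (x.1.2 s).submodule) :
    Filter.Tendsto (fun t : ℂ => liftPoint x (x.1.1 + t • d)) (𝓝[≠] 0) (𝓝 x) := by
  rw [BlowUp.isClosedEmbedding_toProd.isInducing.tendsto_nhds_iff]
  have hc : Filter.Tendsto (fun t : ℂ => x.1.1 + t • d) (𝓝[≠] 0) (𝓝 x.1.1) := by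
    have : Continuous fun t : ℂ => x.1.1 + t • d := by fun_prop
    exact (this.tendsto' 0 _ (by simp)).mono_left nhdsWithin_le_nhds
  refine Filter.Tendsto.prodMk_nhds hc (tendsto_pi_nhds.mpr fun s => ?_)
  by_cases hs : x.1.1 = s
  · refine tendsto_const_nhds.congr' ?_
    filter_upwards [self_mem_nhdsWithin] with t ht
    have e : x.1.1 + t • d - s = t • d := by rw [hs]; abel
    have hne : x.1.1 + t • d - s ≠ 0 := by rw [e]; exact smul_ne_zero ht hd
    change _ = (liftPoint x (x.1.1 + t • d)).1.2 s
    rw [liftPoint_direction x hne]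
    refine submodule_eq_of_mem hne ?_
    rw [e]
    exact Submodule.smul_mem _ t (h s hs)
  · have hne : x.1.1 - s ≠ 0 := sub_ne_zero.mpr hs
    have := continuousAt_direction x.1.1 hne (f := fun p => (liftPoint x p).1.2 s)
      fun q hq => liftPoint_direction x hq
    have h2 : (liftPoint x x.1.1).1.2 s = x.1.2 s := by
      rw [liftPoint_direction x hne, direction_eq x hne]
    have h3 := this.tendsto.comp hc
    rw [h2] at h3
    exact h3

/-! Tubular neighbourhoods of the proper transforms of lines. -/

/-- The open tube of radius `ε` around the proper transform of the line `lineForm i = b`. -/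
def openTube (i : Fin 4) (b : ℂ) (ε : ℝ) : Set BlowUp :=
  {x | ‖lineForm i x.1.1 - b‖ < ε ∧ ∀ s : lattice, lineForm i s = b →
    ∀ v ∈ (x.1.2 s).submodule, v ≠ 0 → ‖lineForm i v‖ < ε * ‖coordForm i v‖}

/-- The closed tube of radius `ε` around the proper transform of the line `lineForm i = b`.
For `ε = 0` it is the proper transform itself. -/
def closedTube (i : Fin 4) (b : ℂ) (ε : ℝ) : Set BlowUp :=
  {x | ‖lineForm i x.1.1 - b‖ ≤ ε ∧ ∀ s : lattice, lineForm i s = b →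
    ∀ v ∈ (x.1.2 s).submodule, ‖lineForm i v‖ ≤ ε * ‖coordForm i v‖}

theorem exists_smul_eq_of_mem {ℓ : ℙ ℂ (ℂ × ℂ)} {v w : ℂ × ℂ} (hv : v ∈ ℓ.submodule)
    (hv0 : v ≠ 0) (hw : w ∈ ℓ.submodule) : ∃ a : ℂ, w = a • v := by
  rw [submodule_eq_of_mem hv0 hv, Projectivization.submodule_mk,
    Submodule.mem_span_singleton] at hw
  exact hw.imp fun _ => Eq.symm

theorem eq_zero_of_forms_eq_zero (i : Fin 4) {v : ℂ × ℂ} (h : coordForm i v = 0)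
    (h' : lineForm i v = 0) : v = 0 :=
  eq_of_forms_eq i (by simpa using h) (by simpa using h')

theorem openTube_subset_closedTube (i : Fin 4) (b : ℂ) (ε : ℝ) :
    openTube i b ε ⊆ closedTube i b ε := by
  rintro x ⟨h, h'⟩
  refine ⟨h.le, fun s hs v hv => ?_⟩
  by_cases hv0 : v = 0
  · simp [hv0]
  · exact (h' s hs v hv hv0).le

theorem closedTube_subset_openTube (i : Fin 4) (b : ℂ) {ε ε' : ℝ} (hε : ε < ε') :
    closedTube i b ε ⊆ openTube i b ε' := by
  rintro x ⟨h, h'⟩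
  refine ⟨h.trans_lt hε, fun s hs v hv hv0 => (h' s hs v hv).trans_lt ?_⟩
  refine mul_lt_mul_of_pos_right hε (norm_pos_iff.mpr fun h0 => hv0 ?_)
  refine eq_zero_of_forms_eq_zero i h0 ?_
  simpa [h0] using h' s hs v hv

theorem openTube_mono (i : Fin 4) (b : ℂ) {ε ε' : ℝ} (hε : ε ≤ ε') :
    openTube i b ε ⊆ openTube i b ε' := by
  rintro x ⟨h, h'⟩
  exact ⟨h.trans_le hε, fun s hs v hv hv0 => (h' s hs v hv hv0).trans_le
    (mul_le_mul_of_nonneg_right hε (norm_nonneg _))⟩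

theorem isClosed_closedTube (i : Fin 4) (b : ℂ) (ε : ℝ) : IsClosed (closedTube i b ε) := by
  have h : closedTube i b ε = {x : BlowUp | ‖lineForm i x.1.1 - b‖ ≤ ε} ∩
      ⋂ s : {s : lattice // lineForm i s = b}, (fun x : BlowUp => x.1.2 s.1) ⁻¹'
        {ℓ | ∀ v ∈ ℓ.submodule, ‖lineForm i v‖ ≤ ε * ‖coordForm i v‖} := by
    ext x
    rw [Set.mem_inter_iff, Set.mem_iInter, Subtype.forall]
    rfl
  rw [h]
  refine IsClosed.inter ?_ (isClosed_iInter fun s =>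
    (isClosed_slope_le i ε).preimage (continuous_direction s.1))
  exact isClosed_le (((lineForm i).continuous.comp continuous_point).sub continuous_const).norm
    continuous_const

theorem isClosed_iUnion_closedTube (i : Fin 4) (ε : ℝ) :
    IsClosed (⋃ b : eisenstein, closedTube i b ε) := by
  refine LocallyFinite.isClosed_iUnion ?_ fun b => isClosed_closedTube i b ε
  refine ((locallyFinite_closedBall_eisenstein ε).preimage_continuous
    ((lineForm i).continuous.comp continuous_point)).subset fun b x hx => ?_
  simpa [dist_eq_norm] using hx.1

/-- The tube imposes infinitely many direction conditions, one for each lattice point `s` of the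
line. Since `x - s` lies in the direction at `s`, a slope of at least `ε` there forces the
coordinates of `x` and `s` to be within 1 of each other. The bad sets are thus closed and locally
finite. -/
theorem isOpen_openTube (i : Fin 4) {b : ℂ} (hb : b ∈ eisenstein) {ε : ℝ} (hε : 0 < ε) :
    IsOpen (openTube i b ε) := by
  let pt : eisenstein → lattice := fun a => ⟨ofCoords i a b, ofCoords_mem_lattice i a.2 hb⟩
  let bad : eisenstein → Set BlowUp := fun a =>
    (fun x : BlowUp => x.1.2 (pt a)) ⁻¹'
        {ℓ | ∀ v ∈ ℓ.submodule, ε * ‖coordForm i v‖ ≤ ‖lineForm i v‖} ∩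
      (coordForm i ∘ fun x : BlowUp => x.1.1) ⁻¹' Metric.closedBall (a : ℂ) 1
  have hbad : IsClosed (⋃ a, bad a) := by
    have hc : Continuous (coordForm i ∘ fun x : BlowUp => x.1.1) :=
      (coordForm i).continuous.comp continuous_point
    refine LocallyFinite.isClosed_iUnion ?_ fun a => ?_
    · exact ((locallyFinite_closedBall_eisenstein 1).preimage_continuous hc).subset
        fun a => Set.inter_subset_right
    · exact ((isClosed_le_slope i ε).preimage (continuous_direction (pt a))).inter
        (Metric.isClosed_closedBall.preimage hc)
  have h : openTube i b ε = {x : BlowUp | ‖lineForm i x.1.1 - b‖ < ε} ∩ (⋃ a, bad a)ᶜ := by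
    ext x
    simp only [Set.mem_inter_iff, Set.mem_compl_iff, Set.mem_iUnion, not_exists]
    refine and_congr_right fun hx => ⟨fun h a ha => ?_, fun h s hs v hv hv0 => ?_⟩
    · obtain ⟨v, hv, hv0⟩ := exists_ne_zero_mem (x.1.2 (pt a))
      exact absurd (h (pt a) (lineForm_ofCoords i _ _) v hv hv0) (not_lt.mpr (ha.1 v hv))
    · by_contra hlt
      rw [not_lt] at hlt
      have hall : ∀ w ∈ (x.1.2 s).submodule, ε * ‖coordForm i w‖ ≤ ‖lineForm i w‖ := by
        intro w hw
        obtain ⟨a, rfl⟩ := exists_smul_eq_of_mem hv hv0 hw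
        rw [map_smul, map_smul, norm_smul, norm_smul, mul_left_comm]
        exact mul_le_mul_of_nonneg_left hlt (norm_nonneg a)
      have hpt : pt ⟨coordForm i s, coordForm_mem i s.2⟩ = s :=
        Subtype.ext (by
          change ofCoords i (coordForm i s) b = s
          rw [← hs, ofCoords_forms])
      refine h ⟨coordForm i s, coordForm_mem i s.2⟩ ⟨?_, ?_⟩
      · rw [Set.mem_preimage, hpt]
        exact hall
      · have h1 := hall _ (x.2 s)
        rw [map_sub, map_sub, hs] at h1
        have h2 : ε * ‖coordForm i x.1.1 - coordForm i s‖ < ε * 1 := by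
          rw [mul_one]; exact h1.trans_lt hx
        have h3 := lt_of_mul_lt_mul_left h2 hε.le
        rw [Set.mem_preimage, mem_closedBall_iff_norm]
        exact h3.le
  rw [h]
  refine IsOpen.inter ?_ hbad.isOpen_compl
  exact isOpen_lt (((lineForm i).continuous.comp continuous_point).sub continuous_const).norm
    continuous_const

/-- Parallel lines differ by a nonzero Eisenstein integer, of norm at least 1. Lines of different
families meet in a lattice point, where a single direction would need slope below 1/2 relative to
both; adding the two inequalities of `norm_coordForm_le_of_ne` excludes this. -/
theorem eq_of_mem_openTube {i j : Fin 4} {b c : ℂ} (hb : b ∈ eisenstein) (hc : c ∈ eisenstein)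
    {ε : ℝ} (hε : ε ≤ 1 / 2) {x : BlowUp} (hx : x ∈ openTube i b ε) (hx' : x ∈ openTube j c ε) :
    i = j ∧ b = c := by
  by_cases hij : i = j
  · subst hij
    refine ⟨rfl, ?_⟩
    by_contra hbc
    have h := one_le_norm (eisenstein.sub_mem hb hc) (sub_ne_zero.mpr hbc)
    have e : b - c = (lineForm i x.1.1 - c) - (lineForm i x.1.1 - b) := by ring
    have h2 := norm_sub_le (lineForm i x.1.1 - c) (lineForm i x.1.1 - b)
    rw [← e] at h2
    linarith [hx.1, hx'.1]
  · exfalso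
    obtain ⟨s, hs, hsb, hsc⟩ := exists_mem_lattice_of_ne hij hb hc
    obtain ⟨v, hv, hv0⟩ := exists_ne_zero_mem (x.1.2 ⟨s, hs⟩)
    have h1 := hx.2 ⟨s, hs⟩ hsb v hv hv0
    have h2 := hx'.2 ⟨s, hs⟩ hsc v hv hv0
    have h3 := norm_coordForm_le_of_ne hij v
    have h4 := norm_coordForm_le_of_ne (Ne.symm hij) v
    nlinarith [norm_nonneg (coordForm i v), norm_nonneg (coordForm j v)]

theorem vadd_mem_openTube_iff (μ : lattice) (i : Fin 4) (b : ℂ) (ε : ℝ) (x : BlowUp) :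
    μ +ᵥ x ∈ openTube i b ε ↔ x ∈ openTube i (b - lineForm i μ) ε := by
  have e : lineForm i (μ +ᵥ x).1.1 - b = lineForm i x.1.1 - (b - lineForm i μ) := by
    rw [vadd_point, map_add]; ring
  refine and_congr (by rw [e]) ⟨fun h s hs v hv => ?_, fun h s hs v hv => ?_⟩
  · refine h (s + μ) ?_ v ?_
    · rw [Submodule.coe_add, map_add, hs]; ring
    · rwa [vadd_direction, add_sub_cancel_right]
  · refine h (s - μ) ?_ v hv
    rw [Submodule.coe_sub, map_sub, hs]

theorem vadd_mem_closedTube_iff (μ : lattice) (i : Fin 4) (b : ℂ) (ε : ℝ) (x : BlowUp) :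
    μ +ᵥ x ∈ closedTube i b ε ↔ x ∈ closedTube i (b - lineForm i μ) ε := by
  have e : lineForm i (μ +ᵥ x).1.1 - b = lineForm i x.1.1 - (b - lineForm i μ) := by
    rw [vadd_point, map_add]; ring
  refine and_congr (by rw [e]) ⟨fun h s hs v hv => ?_, fun h s hs v hv => ?_⟩
  · refine h (s + μ) ?_ v ?_
    · rw [Submodule.coe_add, map_add, hs]; ring
    · rwa [vadd_direction, add_sub_cancel_right]
  · refine h (s - μ) ?_ v hv
    rw [Submodule.coe_sub, map_sub, hs]

instance : Nonempty BlowUp := by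
  have h : ∀ v : ℂ × ℂ, ∃ ℓ : ℙ ℂ (ℂ × ℂ), v ∈ ℓ.submodule := by
    intro v
    by_cases hv : v = 0
    · exact ⟨Projectivization.mk ℂ (1, 0) (by simp), hv ▸ Submodule.zero_mem _⟩
    · refine ⟨Projectivization.mk ℂ v hv, ?_⟩
      rw [Projectivization.submodule_mk]
      exact Submodule.mem_span_singleton_self v
  choose f hf using h
  exact ⟨⟨(0, fun s => f (0 - s)), fun s => hf _⟩⟩

/-! ### Connectedness of punctured tubes -/

/-- A punctured tube is a punctured disc bundle over the complement of the lattice points of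
the line, together with some limit points. -/
def puncturedTube (i : Fin 4) (b : ℂ) (ε : ℝ) : Set BlowUp := openTube i b ε \ closedTube i b 0

/-- The width of the tubes over the point with coordinate `z` on the line. -/
def width (z : ℂ) : ℝ := min 1 (Metric.infDist z eisenstein)

theorem eisenstein_nonempty : (eisenstein : Set ℂ).Nonempty := ⟨0, eisenstein.zero_mem⟩

theorem width_pos {z : ℂ} (hz : z ∉ eisenstein) : 0 < width z :=
  lt_min one_pos ((isClosed_eisenstein.notMem_iff_infDist_pos eisenstein_nonempty).mp hz)

theorem continuous_width : Continuous width :=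
  continuous_const.min (Metric.continuous_infDist_pt _)

/-- The parametrization of the part of a tube outside of the exceptional curves. -/
def tubeMap (i : Fin 4) (b : ℂ) (q : ℂ × ℂ) : ℂ × ℂ := ofCoords i q.1 (b + q.2 * width q.1)

theorem isPreconnected_puncturedDisc (ε : ℝ) : IsPreconnected (Metric.ball (0 : ℂ) ε \ {0}) := by
  rcases le_or_gt ε 0 with h | h
  · rw [Metric.ball_eq_empty.mpr h, Set.empty_sdiff]
    exact isPreconnected_empty
  · have e : Metric.ball (0 : ℂ) ε \ {0} = Complex.exp '' {z | z.re < Real.log ε} := by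
      ext z
      simp only [Set.mem_sdiff, mem_ball_zero_iff, Set.mem_singleton_iff, Set.mem_image,
        Set.mem_ofPred_eq]
      constructor
      · rintro ⟨hz, hz0⟩
        refine ⟨Complex.log z, ?_, Complex.exp_log hz0⟩
        rw [Complex.log_re]
        exact Real.log_lt_log (norm_pos_iff.mpr hz0) hz
      · rintro ⟨w, hw, rfl⟩
        refine ⟨?_, Complex.exp_ne_zero w⟩
        rw [Complex.norm_exp]
        exact (Real.lt_log_iff_exp_lt h).mp hw
    rw [e]
    exact (convex_halfSpace_re_lt _).isPreconnected.image _ Complex.continuous_exp.continuousOn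

/-- The bound of `width` by 1 controls the distance to the line, and its bound by the distance to
ℤ[ρ] controls the slope at every lattice point of the line. -/
theorem liftPoint_tubeMap_mem {i : Fin 4} {b : ℂ} {ε : ℝ} (x₀ : BlowUp)
    {z u : ℂ} (hz : z ∉ eisenstein) (hu : u ∈ Metric.ball (0 : ℂ) ε \ {0}) :
    liftPoint x₀ (tubeMap i b (z, u)) ∈ puncturedTube i b ε := by
  have hw := width_pos hz
  have hu1 : ‖u‖ < ε := by simpa using hu.1
  have hu0 : 0 < ‖u‖ := norm_pos_iff.mpr hu.2
  have hβ : lineForm i (tubeMap i b (z, u)) - b = u * width z := by simp [tubeMap]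
  have hα : coordForm i (tubeMap i b (z, u)) = z := by simp [tubeMap]
  have hn : ‖u * (width z : ℂ)‖ = ‖u‖ * width z := by
    rw [norm_mul, Complex.norm_of_nonneg hw.le]
  refine ⟨⟨?_, fun s hs v hv hv0 => ?_⟩, fun h => ?_⟩
  · rw [liftPoint_point, hβ, hn]
    calc ‖u‖ * width z ≤ ‖u‖ * 1 := by gcongr; exact min_le_left _ _
      _ < ε := by rwa [mul_one]
  · have hs' : coordForm i s ∈ eisenstein := coordForm_mem i s.2
    have hα' : coordForm i (tubeMap i b (z, u) - s) ≠ 0 := by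
      rw [map_sub, hα, sub_ne_zero]
      rintro rfl
      exact hz hs'
    have hne : tubeMap i b (z, u) - s ≠ 0 := fun h => hα' (by rw [h, map_zero])
    rw [liftPoint_direction x₀ hne, Projectivization.submodule_mk,
      Submodule.mem_span_singleton] at hv
    obtain ⟨a, rfl⟩ := hv
    have ha : 0 < ‖a‖ := norm_pos_iff.mpr fun h => hv0 (by rw [h, zero_smul])
    rw [map_smul, map_smul, norm_smul, norm_smul, mul_left_comm]
    refine mul_lt_mul_of_pos_left ?_ ha
    rw [map_sub, map_sub, hs, hβ, hα, hn]
    have h1 : width z ≤ ‖z - coordForm i s‖ := by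
      rw [← dist_eq_norm]
      exact (min_le_right _ _).trans (Metric.infDist_le_dist_of_mem hs')
    exact mul_lt_mul hu1 h1 hw (hu0.trans hu1).le
  · have h1 := h.1
    rw [liftPoint_point, hβ, hn] at h1
    exact absurd h1 (not_le.mpr (mul_pos hu0 hw))

/-- A plane without a countable set is connected, and so is its product with a punctured disc. -/
theorem isPreconnected_tubeMap_image (i : Fin 4) (b : ℂ) (ε : ℝ) (x₀ : BlowUp) :
    IsPreconnected ((fun q => liftPoint x₀ (tubeMap i b q)) ''
      ((eisenstein : Set ℂ)ᶜ ×ˢ (Metric.ball (0 : ℂ) ε \ {0}))) := by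
  have hcount : (eisenstein : Set ℂ).Countable := by
    have : (eisenstein : Set ℂ) = Set.range fun q : ℤ × ℤ => (q.1 : ℂ) + q.2 * ρ := by
      ext x
      simp only [SetLike.mem_coe, mem_eisenstein, Set.mem_range, Prod.exists, eq_comm]
    rw [this]
    exact Set.countable_range _
  have h1 : IsPreconnected (eisenstein : Set ℂ)ᶜ :=
    (hcount.isPathConnected_compl_of_one_lt_rank
      (by rw [Complex.rank_real_complex]; exact Cardinal.one_lt_two)).isConnected.isPreconnected
  refine (h1.prod (isPreconnected_puncturedDisc ε)).image _ ?_
  rintro ⟨z, u⟩ ⟨hz, -⟩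
  have hl : tubeMap i b (z, u) ∉ lattice := fun h => hz (by
    have := coordForm_mem i h
    simpa [tubeMap] using this)
  have hc : Continuous (tubeMap i b) := by
    have := continuous_width
    exact (continuous_ofCoords i).comp (f := fun q : ℂ × ℂ => (q.1, b + q.2 * (width q.1 : ℂ)))
      (by fun_prop)
  exact (ContinuousAt.comp (g := liftPoint x₀) (continuousAt_liftPoint x₀ hl)
    hc.continuousAt).continuousWithinAt

theorem exists_tubeMap_eq {i : Fin 4} {b : ℂ} (hb : b ∈ eisenstein) {ε : ℝ} (x₀ : BlowUp)
    {x : BlowUp} (hx : x ∈ puncturedTube i b ε)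
    (hreg : ∀ s : lattice, lineForm i s = b → x.1.1 ≠ s) :
    x ∈ (fun q => liftPoint x₀ (tubeMap i b q)) ''
      ((eisenstein : Set ℂ)ᶜ ×ˢ (Metric.ball (0 : ℂ) ε \ {0})) := by
  have hβ : lineForm i x.1.1 - b ≠ 0 := by
    intro h
    refine hx.2 ⟨by rw [h, norm_zero], fun s hs v hv => ?_⟩
    obtain ⟨a, rfl⟩ := exists_smul_eq_of_mem (x.2 s) (sub_ne_zero.mpr (hreg s hs)) hv
    rw [map_smul, map_sub, hs, h]
    simp
  have key : ∀ a ∈ eisenstein, ‖lineForm i x.1.1 - b‖ < ε * ‖coordForm i x.1.1 - a‖ := by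
    intro a ha
    have h := hx.1.2 ⟨ofCoords i a b, ofCoords_mem_lattice i ha hb⟩ (lineForm_ofCoords i a b) _
      (x.2 _) (sub_ne_zero.mpr (hreg _ (lineForm_ofCoords i a b)))
    simpa using h
  have hz : coordForm i x.1.1 ∉ eisenstein := by
    intro h
    have h1 := key _ h
    rw [sub_self, norm_zero, mul_zero] at h1
    exact absurd h1 (not_lt.mpr (norm_nonneg _))
  have hw := width_pos hz
  have hwc : (width (coordForm i x.1.1) : ℂ) ≠ 0 := by exact_mod_cast hw.ne'
  -- The distance to the closed set ℤ[ρ] is attained, so the strict bounds at the individual lattice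
  -- points give a strict bound for the minimum.
  have hlt : ‖lineForm i x.1.1 - b‖ < ε * width (coordForm i x.1.1) := by
    rcases min_choice 1 (Metric.infDist (coordForm i x.1.1) eisenstein) with h | h
    · rw [width, h, mul_one]
      exact hx.1.1
    · obtain ⟨a, ha, hda⟩ :=
        isClosed_eisenstein.exists_infDist_eq_dist eisenstein_nonempty (coordForm i x.1.1)
      rw [width, h, hda, dist_eq_norm]
      exact key a ha
  have hpt : tubeMap i b (coordForm i x.1.1,
      (lineForm i x.1.1 - b) / width (coordForm i x.1.1)) = x.1.1 := by
    refine eq_of_forms_eq i (by simp [tubeMap]) ?_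
    rw [tubeMap, lineForm_ofCoords]
    field_simp
    ring
  refine ⟨(coordForm i x.1.1, (lineForm i x.1.1 - b) / width (coordForm i x.1.1)),
    ⟨hz, ?_, ?_⟩, ?_⟩
  · rw [mem_ball_zero_iff, norm_div, Complex.norm_of_nonneg hw.le]
    exact (div_lt_iff₀ hw).mpr hlt
  · exact div_ne_zero hβ hwc
  · dsimp only
    rw [hpt]
    exact eq_of_point_eq rfl fun h => hz (coordForm_mem i h)

/-- The tube lies between the connected image of `tubeMap` and its closure. The points missed by the
image lie on exceptional curves and are reached along the lines in ℂ² with their own directions. -/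
theorem isPreconnected_puncturedTube (i : Fin 4) {b : ℂ} (hb : b ∈ eisenstein) {ε : ℝ}
    (hε : 0 < ε) : IsPreconnected (puncturedTube i b ε) := by
  obtain ⟨x₀⟩ : Nonempty BlowUp := inferInstance
  refine (isPreconnected_tubeMap_image i b ε x₀).subset_closure ?_ fun x hx => ?_
  · rintro _ ⟨⟨z, u⟩, ⟨hz, hu⟩, rfl⟩
    exact liftPoint_tubeMap_mem x₀ hz hu
  · by_cases hreg : ∀ s : lattice, lineForm i s = b → x.1.1 ≠ s
    · exact subset_closure (exists_tubeMap_eq hb x₀ hx hreg)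
    push Not at hreg
    obtain ⟨s, hs, hxs⟩ := hreg
    obtain ⟨v, hv, hv0⟩ := exists_ne_zero_mem (x.1.2 s)
    -- A direction along the line would put `x` on the proper transform.
    have hβv : lineForm i v ≠ 0 := by
      intro h
      refine hx.2 ⟨by rw [hxs, hs, sub_self, norm_zero], fun s' hs' w hw => ?_⟩
      by_cases hss : s' = s
      · subst hss
        obtain ⟨a, rfl⟩ := exists_smul_eq_of_mem hv hv0 hw
        simp [h]
      · have hne : x.1.1 - s' ≠ 0 := by
          rw [hxs, sub_ne_zero]
          exact fun h => hss (Subtype.ext h.symm)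
        obtain ⟨a, rfl⟩ := exists_smul_eq_of_mem (x.2 s') hne hw
        simp [hxs, hs, hs']
    have ht := tendsto_liftPoint x hv0 fun s' hs' => by
      rwa [← Subtype.ext (hxs.symm.trans hs')]
    refine mem_closure_of_tendsto ht ?_
    filter_upwards [ht.eventually ((isOpen_openTube i hb hε).mem_nhds hx.1),
      self_mem_nhdsWithin] with t hopen ht0
    have hb' : lineForm i (x.1.1 + t • v) - b = t * lineForm i v := by
      simp [hxs, hs]
    have hb0 : lineForm i (x.1.1 + t • v) - b ≠ 0 := by
      rw [hb']
      exact mul_ne_zero ht0 hβv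
    refine exists_tubeMap_eq hb x₀ ⟨hopen, fun h => ?_⟩ fun s' hs' h => ?_
    · exact absurd h.1 (not_le.mpr (norm_pos_iff.mpr hb0))
    · rw [liftPoint_point] at h
      exact hb0 (by rw [h, hs', sub_self])

theorem puncturedTube_nonempty (i : Fin 4) (b : ℂ) {ε : ℝ} (hε : 0 < ε) :
    (puncturedTube i b ε).Nonempty := by
  obtain ⟨x₀⟩ : Nonempty BlowUp := inferInstance
  have hz : (1 / 2 : ℂ) ∉ eisenstein := fun h => by
    have := one_le_norm h (by norm_num)
    norm_num at this
  refine ⟨_, liftPoint_tubeMap_mem x₀ hz (u := ((ε / 2 : ℝ) : ℂ)) ⟨?_, ?_⟩⟩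
  · rw [mem_ball_zero_iff, Complex.norm_of_nonneg (by positivity)]
    linarith
  · simpa using hε.ne'

/-- Radii below 1/2 force the same line at all levels, so the inequalities pass to the limit. -/
theorem exists_mem_closedTube_zero {x : BlowUp}
    (h : ∀ n : ℕ, ∃ i, ∃ b : eisenstein, x ∈ closedTube i b (1 / (n + 3))) :
    ∃ i, ∃ b : eisenstein, x ∈ closedTube i b 0 := by
  choose i b hib using h
  have hlt : ∀ n : ℕ, (1 / (n + 3) : ℝ) < 1 / 2 := fun n =>
    one_div_lt_one_div_of_lt two_pos (by linarith [n.cast_nonneg (α := ℝ)])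
  have hconst : ∀ n, i n = i 0 ∧ (b n : ℂ) = b 0 := fun n =>
    eq_of_mem_openTube (b n).2 (b 0).2 le_rfl (closedTube_subset_openTube _ _ (hlt n) (hib n))
      (closedTube_subset_openTube _ _ (hlt 0) (hib 0))
  have h0 : ∀ n : ℕ, x ∈ closedTube (i 0) (b 0) (1 / (n + 3)) := fun n => by
    have := hib n
    rwa [(hconst n).1, (hconst n).2] at this
  have hlim : Filter.Tendsto (fun n : ℕ => (1 / (n + 3) : ℝ)) Filter.atTop (𝓝 0) := by
    have h1 : Filter.Tendsto (fun n : ℕ => (n : ℝ) + 3) Filter.atTop Filter.atTop :=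
      Filter.tendsto_atTop_add_const_right _ _ tendsto_natCast_atTop_atTop
    exact h1.const_div_atTop 1
  refine ⟨i 0, b 0, ge_of_tendsto' hlim fun n => (h0 n).1, fun s hs v hv => ?_⟩
  exact ge_of_tendsto' (hlim.mul_const _) fun n => (h0 n).2 s hs v hv

/-! The cusps of the complement of the proper transforms. -/

/-- The projection from the blow-up of `ℂ²` to the blow-up of a torus. -/
def proj (K : AddSubgroup lattice) (x : BlowUp) : BlowUpTorus K := Quotient.mk _ x

section

variable (K : AddSubgroup lattice)

theorem proj_eq_proj_iff {x y : BlowUp} : proj K x = proj K y ↔ ∃ k ∈ K, k +ᵥ y = x := by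
  rw [proj, proj, Quotient.eq, AddAction.orbitRel_apply, AddAction.mem_orbit_iff]
  exact ⟨fun ⟨k, hk⟩ => ⟨k, k.2, hk⟩, fun ⟨k, hk, h⟩ => ⟨⟨k, hk⟩, h⟩⟩

theorem proj_surjective : Function.Surjective (proj K) := Quotient.mk_surjective

theorem isOpenMap_proj : IsOpenMap (proj K) := isOpenMap_quotient_mk'_add

theorem continuous_proj : Continuous (proj K) := continuous_quotient_mk'

/-- By invariance the complement of the image is the image of the open complement. -/
theorem isClosed_image_proj {S : Set BlowUp} (hS : IsClosed S)
    (hinv : ∀ k ∈ K, ∀ x, k +ᵥ x ∈ S → x ∈ S) : IsClosed (proj K '' S) := by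
  rw [← isOpen_compl_iff]
  convert isOpenMap_proj K _ hS.isOpen_compl using 1
  ext y
  obtain ⟨x, rfl⟩ := proj_surjective K y
  constructor
  · exact fun h => ⟨x, fun hx => h ⟨x, hx, rfl⟩, rfl⟩
  · rintro ⟨x', hx', he⟩ ⟨x'', hx'', he'⟩
    obtain ⟨k, hk, rfl⟩ := (proj_eq_proj_iff K).mp (he'.trans he.symm)
    exact hx' (hinv k hk _ hx'')

/-- With `N` the index, `K` contains `N` times the lattice. Every orbit thus has a point over the
ball of radius 2N, whose preimage is compact. -/
theorem compactSpace_blowUpTorus [K.FiniteIndex] : CompactSpace (BlowUpTorus K) := by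
  set N := K.index with hN
  have hN0 : (N : ℂ) ≠ 0 := by exact_mod_cast AddSubgroup.FiniteIndex.index_ne_zero
  have hc := isCompact_point_preimage (isCompact_closedBall (0 : ℂ × ℂ) (N * 2))
  refine ⟨?_⟩
  convert hc.image (continuous_proj K)
  symm
  rw [Set.eq_univ_iff_forall]
  intro y
  obtain ⟨x, rfl⟩ := proj_surjective K y
  obtain ⟨a, ha, hza⟩ := exists_eisenstein_norm_sub_le (x.1.1.1 / N)
  obtain ⟨b, hb, hwb⟩ := exists_eisenstein_norm_sub_le (x.1.1.2 / N)
  have hs : (a, b) ∈ lattice := mem_lattice.mpr ⟨ha, hb⟩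
  let s : lattice := ⟨(a, b), hs⟩
  have hk : -(N • s) ∈ K := K.neg_mem (K.nsmul_index_mem s)
  have hbound : ∀ z c : ℂ, ‖z / N - c‖ ≤ 2 → ‖-(N * c) + z‖ ≤ N * 2 := by
    intro z c h
    have e : -(N * c) + z = N * (z / N - c) := by field_simp; ring
    rw [e, norm_mul, Complex.norm_natCast]
    gcongr
  refine ⟨-(N • s) +ᵥ x, ?_, (proj_eq_proj_iff K).mpr ⟨_, hk, rfl⟩⟩
  change (-(N • s) +ᵥ x).1.1 ∈ Metric.closedBall (0 : ℂ × ℂ) (N * 2)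
  have e : (-(N • s) +ᵥ x).1.1 = (-(N * a) + x.1.1.1, -(N * b) + x.1.1.2) := by
    rw [vadd_point]
    ext <;> simp [s]
  rw [e, mem_closedBall_zero_iff, Prod.norm_def]
  exact max_le (hbound _ _ hza) (hbound _ _ hwb)

end

/-- The proper transforms of all the translates of the lines `line i` by lattice points. -/
def properTransforms : Set BlowUp := ⋃ i, ⋃ b : eisenstein, closedTube i b 0

theorem exists_lineForm_eq (i : Fin 4) (b : eisenstein) : ∃ s : lattice, lineForm i s = b :=
  ⟨⟨ofCoords i 0 b, ofCoords_mem_lattice i eisenstein.zero_mem b.2⟩, lineForm_ofCoords i 0 b⟩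

theorem vadd_mem_iUnion_closedTube (ε : ℝ) (μ : lattice) (x : BlowUp)
    (h : μ +ᵥ x ∈ ⋃ i, ⋃ b : eisenstein, closedTube i b ε) :
    x ∈ ⋃ i, ⋃ b : eisenstein, closedTube i b ε := by
  simp only [Set.mem_iUnion] at h ⊢
  obtain ⟨i, b, h⟩ := h
  exact ⟨i, ⟨b - lineForm i μ, eisenstein.sub_mem b.2 (lineForm_mem i μ.2)⟩,
    (vadd_mem_closedTube_iff μ i b ε x).mp h⟩

theorem torus_mk_eq_iff {p q : ℂ × ℂ} : Torus.mk ⊤ p = Torus.mk ⊤ q ↔ p - q ∈ lattice := by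
  rw [Torus.mk, Torus.mk, Quotient.eq, AddAction.orbitRel_apply, AddAction.mem_orbit_iff]
  constructor
  · rintro ⟨k, rfl⟩
    change ((k : lattice) : ℂ × ℂ) + q - q ∈ lattice
    rw [add_sub_cancel_right]
    exact k.1.2
  · intro h
    exact ⟨⟨⟨p - q, h⟩, trivial⟩, sub_add_cancel p q⟩

theorem eventually_notMem_lattice (p : ℂ × ℂ) : ∀ᶠ q in 𝓝[≠] p, q ∉ lattice := by
  have hfin : {q : ℂ × ℂ | q ∈ lattice ∧ ‖q - p‖ ≤ 1}.Finite := by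
    refine ((finite_eisenstein_inter_closedBall p.1 1).prod
      (finite_eisenstein_inter_closedBall p.2 1)).subset ?_
    rintro q ⟨hq, hqp⟩
    rw [mem_lattice] at hq
    exact ⟨⟨hq.1, (norm_fst_le (q - p)).trans hqp⟩, ⟨hq.2, (norm_snd_le (q - p)).trans hqp⟩⟩
  have h1 : ∀ᶠ q in 𝓝[≠] p, ‖q - p‖ ≤ 1 := by
    filter_upwards [nhdsWithin_le_nhds (Metric.closedBall_mem_nhds p one_pos)] with q hq
    simpa [dist_eq_norm] using hq
  have h2 : ∀ᶠ q in 𝓝[≠] p, q ∉ {q : ℂ × ℂ | q ∈ lattice ∧ ‖q - p‖ ≤ 1} \ {p} := by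
    refine nhdsWithin_le_nhds ?_
    exact (hfin.subset Set.sdiff_subset).isClosed.isOpen_compl.mem_nhds fun h => h.2 rfl
  filter_upwards [h1, h2, self_mem_nhdsWithin] with q hq1 hq2 hq3 hq
  exact hq2 ⟨⟨hq, hq1⟩, hq3⟩

/-- The image of the proper transforms is closed and contains the curves without the origin, hence
their closures. Conversely, every point of a proper transform is a limit of points of the same line
outside the lattice. -/
theorem proj_mem_D_iff {x : BlowUp} : proj ⊤ x ∈ D ↔ x ∈ properTransforms := by
  constructor
  · intro h
    have hclosed : IsClosed (proj ⊤ '' properTransforms) :=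
      isClosed_image_proj ⊤ (isClosed_iUnion_of_finite fun i => isClosed_iUnion_closedTube i 0)
        fun k _ x => vadd_mem_iUnion_closedTube 0 k x
    have hsub : D ⊆ proj ⊤ '' properTransforms := by
      refine Set.iUnion_subset fun i => closure_minimal ?_ hclosed
      intro y hy
      obtain ⟨x, rfl⟩ := proj_surjective ⊤ y
      obtain ⟨⟨q, hq, hqx⟩, h0⟩ := hy
      change Torus.mk ⊤ q = Torus.mk ⊤ x.1.1 at hqx
      change Torus.mk ⊤ x.1.1 ≠ Torus.mk ⊤ 0 at h0
      rw [Ne, torus_mk_eq_iff, sub_zero] at h0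
      rw [torus_mk_eq_iff] at hqx
      rw [mem_line_iff] at hq
      have hb := lineForm_mem i hqx
      rw [map_sub, hq, zero_sub] at hb
      have hb' := eisenstein.neg_mem hb
      rw [neg_neg] at hb'
      refine ⟨x, Set.mem_iUnion₂.mpr ⟨i, ⟨_, hb'⟩, by simp, fun s hs v hv => ?_⟩, rfl⟩
      have hne : x.1.1 - s ≠ 0 := fun h => h0 (by rw [sub_eq_zero.mp h]; exact s.2)
      obtain ⟨a, rfl⟩ := exists_smul_eq_of_mem (x.2 s) hne hv
      rw [map_smul, map_sub, hs]
      simp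
    obtain ⟨x', hx', he⟩ := hsub h
    obtain ⟨k, -, rfl⟩ := (proj_eq_proj_iff ⊤).mp he
    exact vadd_mem_iUnion_closedTube 0 k x hx'
  · intro h
    simp only [properTransforms, Set.mem_iUnion] at h
    obtain ⟨i, b, hx⟩ := h
    obtain ⟨s₀, hs₀⟩ := exists_lineForm_eq i b
    have hxb : lineForm i x.1.1 = b := by
      have := hx.1
      simpa [sub_eq_zero] using this
    let d := ofCoords i 1 0
    have hd : d ≠ 0 := fun h => by
      have := coordForm_ofCoords i 1 0
      rw [show ofCoords i 1 0 = 0 from h, map_zero] at this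
      exact zero_ne_one this
    have ht := tendsto_liftPoint x hd fun s hs => by
      obtain ⟨v, hv, hv0⟩ := exists_ne_zero_mem (x.1.2 s)
      have h1 := hx.2 s (by rw [← hs, hxb]) v hv
      have h2 : lineForm i v = 0 := by simpa using h1
      have h3 : coordForm i v ≠ 0 := fun h => hv0 (eq_zero_of_forms_eq_zero i h h2)
      have h4 : d = (coordForm i v)⁻¹ • v := by
        refine eq_of_forms_eq i ?_ ?_
        · simp [d, h3]
        · simp [d, h2]
      rw [h4]
      exact Submodule.smul_mem _ _ hv
    refine Set.mem_iUnion.mpr ⟨i, ?_⟩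
    refine mem_closure_of_tendsto (((continuous_proj ⊤).tendsto x).comp ht) ?_
    have hq : Filter.Tendsto (fun t : ℂ => x.1.1 + t • d) (𝓝[≠] 0) (𝓝[≠] x.1.1) := by
      refine tendsto_nhdsWithin_iff.mpr ⟨?_, ?_⟩
      · have : Continuous fun t : ℂ => x.1.1 + t • d := by fun_prop
        exact (this.tendsto' 0 _ (by simp)).mono_left nhdsWithin_le_nhds
      · filter_upwards [self_mem_nhdsWithin] with t ht0
        exact fun h => smul_ne_zero ht0 hd (left_eq_add.mp (Eq.symm h))
    filter_upwards [hq.eventually (eventually_notMem_lattice x.1.1)] with t htl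
    refine ⟨⟨x.1.1 + t • d - s₀, ?_, ?_⟩, ?_⟩
    · rw [mem_line_iff, map_sub, map_add, map_smul, hxb, hs₀]
      simp [d]
    · change Torus.mk ⊤ _ = Torus.mk ⊤ (x.1.1 + t • d)
      rw [torus_mk_eq_iff, sub_sub_cancel_left]
      exact lattice.neg_mem s₀.2
    · change Torus.mk ⊤ (x.1.1 + t • d) ≠ Torus.mk ⊤ 0
      rwa [Ne, torus_mk_eq_iff, sub_zero]

/-- The fundamental group of the elliptic curve `T i`. -/
def lineLattice (i : Fin 4) : AddSubgroup lattice where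
  carrier := {s | lineForm i s = 0}
  zero_mem' := map_zero (lineForm i)
  add_mem' {s t} hs ht := by
    change lineForm i ((s : ℂ × ℂ) + t) = 0
    rw [map_add, hs, ht, add_zero]
  neg_mem' {s} hs := by
    change lineForm i (-(s : ℂ × ℂ)) = 0
    rw [map_neg, hs, neg_zero]

theorem mem_lineLattice {i : Fin 4} {s : lattice} : s ∈ lineLattice i ↔ lineForm i s = 0 := Iff.rfl

/-! ### Neighbourhoods of the cusps in the quotient -/

section

variable (K : AddSubgroup lattice)

/-- The components of the preimage of `D` in the blow-up of `ℂ² / K`. -/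
abbrev CuspIndex : Type := Σ i, lattice ⧸ (K ⊔ lineLattice i)

variable {K}

/-- Here t - s = k + l, where `k` is in `K` and `l` preserves every line of the family. -/
theorem exists_vadd_mem_openTube {i : Fin 4} {s t : lattice} {ε : ℝ} {x : BlowUp}
    (hst : (s : lattice ⧸ (K ⊔ lineLattice i)) = t) (hx : x ∈ openTube i (lineForm i s) ε) :
    ∃ k ∈ K, k +ᵥ x ∈ openTube i (lineForm i t) ε := by
  rw [QuotientAddGroup.eq, AddSubgroup.mem_sup] at hst
  obtain ⟨k, hk, l, hl, h⟩ := hst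
  refine ⟨k, hk, (vadd_mem_openTube_iff _ _ _ _ _).mpr ?_⟩
  have e : t = s + (k + l) := by rw [h]; abel
  have e' : lineForm i t - lineForm i k = lineForm i s := by
    rw [e, Submodule.coe_add, Submodule.coe_add, map_add, map_add, mem_lineLattice.mp hl]
    ring
  rwa [e']

theorem cuspIndex_eq {i j : Fin 4} {s t : lattice} {ε : ℝ} (hε : ε ≤ 1 / 2) {x y : BlowUp}
    (hx : x ∈ openTube i (lineForm i s) ε) (hy : y ∈ openTube j (lineForm j t) ε)
    (hxy : proj K x = proj K y) : (⟨i, s⟩ : CuspIndex K) = ⟨j, t⟩ := by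
  obtain ⟨k, hk, rfl⟩ := (proj_eq_proj_iff K).mp hxy
  rw [vadd_mem_openTube_iff] at hx
  obtain ⟨rfl, h⟩ := eq_of_mem_openTube
    (eisenstein.sub_mem (lineForm_mem i s.2) (lineForm_mem i k.2)) (lineForm_mem j t.2) hε hx hy
  congr 1
  rw [QuotientAddGroup.eq, AddSubgroup.mem_sup]
  refine ⟨-k, K.neg_mem hk, -s + t + k, ?_, by abel⟩
  rw [mem_lineLattice]
  push_cast
  rw [map_add, map_add, map_neg, ← h]
  ring

variable (K)

/-- The preimage of `Y` in the blow-up of `ℂ² / K`. -/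
abbrev cover : Set (BlowUpTorus K) := covering K ⁻¹' Y

/-- The neighbourhoods of the cusps of `cover K`. -/
def cuspNhd (n : ℕ) (c : CuspIndex K) : Set (cover K) :=
  {y | ∃ (s : lattice) (x : BlowUp), (s : lattice ⧸ (K ⊔ lineLattice c.1)) = c.2 ∧
    x ∈ openTube c.1 (lineForm c.1 s) (1 / (n + 3)) ∧ proj K x = y}

variable {K}

theorem proj_mem_cover_iff {x : BlowUp} : proj K x ∈ cover K ↔ x ∉ properTransforms := by
  rw [← proj_mem_D_iff]
  rfl

theorem radius_pos (n : ℕ) : (0 : ℝ) < 1 / (n + 3) := by positivity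

theorem radius_le (n : ℕ) : (1 / (n + 3) : ℝ) ≤ 1 / 2 :=
  one_div_le_one_div_of_le two_pos (by linarith [n.cast_nonneg (α := ℝ)])

theorem isOpen_cuspNhd (n : ℕ) (c : CuspIndex K) : IsOpen (cuspNhd K n c) := by
  have e : cuspNhd K n c = (↑) ⁻¹' (proj K '' ⋃ s : {s : lattice //
      (s : lattice ⧸ (K ⊔ lineLattice c.1)) = c.2},
        openTube c.1 (lineForm c.1 s.1) (1 / (n + 3))) := by
    ext y
    constructor
    · rintro ⟨s, x, hs, hx, h⟩
      exact ⟨x, Set.mem_iUnion.mpr ⟨⟨s, hs⟩, hx⟩, h⟩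
    · rintro ⟨x, hx, h⟩
      obtain ⟨⟨s, hs⟩, hx⟩ := Set.mem_iUnion.mp hx
      exact ⟨s, x, hs, hx, h⟩
  rw [e]
  exact (isOpenMap_proj K _ (isOpen_iUnion fun s =>
    isOpen_openTube _ (lineForm_mem _ s.1.2) (radius_pos n))).preimage continuous_subtype_val

theorem puncturedTube_disjoint {i : Fin 4} {s : lattice} {ε : ℝ} (hε0 : 0 < ε) (hε : ε ≤ 1 / 2)
    {x : BlowUp} (hx : x ∈ puncturedTube i (lineForm i s) ε) : x ∉ properTransforms := by
  intro h
  simp only [properTransforms, Set.mem_iUnion] at h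
  obtain ⟨j, b, h⟩ := h
  obtain ⟨rfl, hb⟩ := eq_of_mem_openTube (lineForm_mem i s.2) b.2 hε hx.1
    (closedTube_subset_openTube _ _ hε0 h)
  exact hx.2 (hb ▸ h)

/-- The tubes of one coset are translates of each other under `K`, so a single punctured tube
suffices; connectedness and nonemptiness descend from it. -/
theorem image_cuspNhd (n : ℕ) (i : Fin 4) (s : lattice) :
    (↑) '' cuspNhd K n ⟨i, s⟩ = proj K '' puncturedTube i (lineForm i s) (1 / (n + 3)) := by
  ext y
  constructor
  · rintro ⟨⟨_, hy⟩, ⟨t, x, ht, hx, rfl⟩, rfl⟩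
    obtain ⟨k, hk, hkx⟩ := exists_vadd_mem_openTube ht hx
    have hp : proj K (k +ᵥ x) = proj K x := (proj_eq_proj_iff K).mpr ⟨k, hk, rfl⟩
    refine ⟨k +ᵥ x, ⟨hkx, fun h => ?_⟩, hp⟩
    change proj K x ∈ cover K at hy
    rw [← hp, proj_mem_cover_iff] at hy
    exact hy (Set.mem_iUnion₂.mpr ⟨i, ⟨_, lineForm_mem i s.2⟩, h⟩)
  · rintro ⟨x, hx, rfl⟩
    have hY := proj_mem_cover_iff (K := K).mpr
      (puncturedTube_disjoint (radius_pos n) (radius_le n) hx)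
    exact ⟨⟨proj K x, hY⟩, ⟨s, x, rfl, hx.1, rfl⟩, rfl⟩

theorem isPreconnected_cuspNhd (n : ℕ) (c : CuspIndex K) : IsPreconnected (cuspNhd K n c) := by
  obtain ⟨i, c⟩ := c
  obtain ⟨s, rfl⟩ := QuotientAddGroup.mk_surjective c
  rw [← IsInducing.subtypeVal.isPreconnected_image, image_cuspNhd]
  exact (isPreconnected_puncturedTube i (lineForm_mem i s.2) (radius_pos n)).image _
    (continuous_proj K).continuousOn

theorem cuspNhd_nonempty (n : ℕ) (c : CuspIndex K) : (cuspNhd K n c).Nonempty := by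
  obtain ⟨i, c⟩ := c
  obtain ⟨s, rfl⟩ := QuotientAddGroup.mk_surjective c
  have h := (puncturedTube_nonempty i (lineForm i s) (radius_pos n)).image (proj K)
  rw [← image_cuspNhd] at h
  exact h.of_image

/-- The open tubes contain the proper transforms, so their complement in the compact blown-up torus
already lies in `cover K`. -/
theorem isCompact_compl_cuspNhd [K.FiniteIndex] (n : ℕ) : IsCompact (⋃ c, cuspNhd K n c)ᶜ := by
  have := compactSpace_blowUpTorus K
  rw [Subtype.isCompact_iff]
  let U : Set BlowUp := ⋃ i, ⋃ s : lattice, openTube i (lineForm i s) (1 / (n + 3))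
  have hU : IsOpen U := isOpen_iUnion fun i => isOpen_iUnion fun s =>
    isOpen_openTube i (lineForm_mem i s.2) (radius_pos n)
  have e : (↑) '' (⋃ c, cuspNhd K n c)ᶜ = (proj K '' U)ᶜ := by
    ext y
    constructor
    · rintro ⟨y, hy, rfl⟩ ⟨x, hx, hxy⟩
      obtain ⟨i, s, hx⟩ := Set.mem_iUnion₂.mp hx
      exact hy (Set.mem_iUnion.mpr ⟨⟨i, s⟩, s, x, rfl, hx, hxy⟩)
    · intro hy
      have hY : y ∈ cover K := by
        obtain ⟨x, rfl⟩ := proj_surjective K y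
        rw [proj_mem_cover_iff]
        intro h
        obtain ⟨i, b, h⟩ := Set.mem_iUnion₂.mp h
        obtain ⟨s, hs⟩ := exists_lineForm_eq i b
        rw [← hs] at h
        exact hy ⟨x, Set.mem_iUnion₂.mpr
          ⟨i, s, closedTube_subset_openTube _ _ (radius_pos n) h⟩, rfl⟩
      refine ⟨⟨y, hY⟩, fun h => ?_, rfl⟩
      obtain ⟨c, s, x, hs, hx, hxy⟩ := Set.mem_iUnion.mp h
      exact hy ⟨x, Set.mem_iUnion₂.mpr ⟨c.1, s, hx⟩, hxy⟩
  rw [e]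
  exact (isOpenMap_proj K U hU).isClosed_compl.isCompact

/-- The closed tubes decrease to the proper transforms, so their complements form a directed open
cover of `B`. -/
theorem exists_cuspNhd_subset_compl (B : Set (cover K)) (hB : IsCompact B) :
    ∃ n, ∀ c, cuspNhd K n c ⊆ Bᶜ := by
  let W : ℕ → Set BlowUp := fun n => ⋃ i, ⋃ b : eisenstein, closedTube i b (1 / (n + 3))
  have hW : ∀ n, IsClosed (proj K '' W n) := fun n =>
    isClosed_image_proj K (isClosed_iUnion_of_finite fun i => isClosed_iUnion_closedTube i _)
      fun k _ x => vadd_mem_iUnion_closedTube _ k x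
  have hanti : Antitone W := by
    intro m n hmn x hx
    obtain ⟨i, b, hx⟩ := Set.mem_iUnion₂.mp hx
    have hr : (1 / (n + 3) : ℝ) ≤ 1 / (m + 3) :=
      one_div_le_one_div_of_le (by positivity) (by gcongr)
    exact Set.mem_iUnion₂.mpr ⟨i, b, hx.1.trans hr, fun s hs v hv => (hx.2 s hs v hv).trans
      (mul_le_mul_of_nonneg_right hr (norm_nonneg _))⟩
  have hcover : B ⊆ ⋃ n, ((↑) ⁻¹' (proj K '' W n)ᶜ : Set (cover K)) := by
    rintro ⟨y, hy⟩ -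
    by_contra hcon
    obtain ⟨x, rfl⟩ := proj_surjective K y
    refine proj_mem_cover_iff.mp hy (Set.mem_iUnion₂.mpr (exists_mem_closedTube_zero fun n => ?_))
    have h : proj K x ∈ proj K '' W n := by
      by_contra h
      exact hcon (Set.mem_iUnion.mpr ⟨n, h⟩)
    obtain ⟨x', hx', he⟩ := h
    obtain ⟨k, -, rfl⟩ := (proj_eq_proj_iff K).mp he
    exact Set.mem_iUnion₂.mp (vadd_mem_iUnion_closedTube _ k x hx')
  obtain ⟨n, hn⟩ := hB.elim_directed_cover _
    (fun n => (hW n).isOpen_compl.preimage continuous_subtype_val) hcover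
    (directed_of_isDirected_le fun m n hmn =>
      Set.preimage_mono (Set.compl_subset_compl.mpr (Set.image_mono (hanti hmn))))
  refine ⟨n, fun c y hy hyB => hn hyB ?_⟩
  obtain ⟨s, x, -, hx, hxy⟩ := hy
  exact ⟨x, Set.mem_iUnion₂.mpr ⟨c.1, ⟨_, lineForm_mem c.1 s.2⟩,
    openTube_subset_closedTube _ _ _ hx⟩, hxy⟩

theorem numEnds_cover (K : AddSubgroup lattice) [K.FiniteIndex] :
    numEnds (cover K) = ∑ i, (K ⊔ lineLattice i).index := by
  have hcard : Nat.card (CuspIndex K) = ∑ i, (K ⊔ lineLattice i).index := by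
    have : ∀ i, (K ⊔ lineLattice i).FiniteIndex := fun i =>
      AddSubgroup.finiteIndex_of_le (le_sup_left (a := K))
    have : ∀ i, Finite (lattice ⧸ (K ⊔ lineLattice i)) := fun i => inferInstance
    exact Nat.card_sigma
  rw [← hcard]
  refine numEnds_eq_card (V := cuspNhd K) isOpen_cuspNhd isPreconnected_cuspNhd cuspNhd_nonempty
    ?_ ?_ isCompact_compl_cuspNhd exists_cuspNhd_subset_compl
  · rintro n ⟨i, c⟩ ⟨j, d⟩ y ⟨s, x, hs, hx, hxy⟩ ⟨t, x', ht, hx', hxy'⟩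
    obtain rfl : (s : lattice ⧸ (K ⊔ lineLattice i)) = c := hs
    obtain rfl : (t : lattice ⧸ (K ⊔ lineLattice j)) = d := ht
    exact cuspIndex_eq (radius_le n) hx hx' (hxy.trans hxy'.symm)
  · rintro m n c hmn y ⟨s, x, hs, hx, hxy⟩
    refine ⟨s, x, hs, openTube_mono _ _ ?_ hx, hxy⟩
    exact one_div_le_one_div_of_le (by positivity) (by gcongr)

end

/-! The index of the image of the fundamental group of `T i` under `σ n j δ`. -/

section

variable (n j : ℕ) (δ : ZMod (3 ^ n))

theorem σ_eq (a b c d : ℤ) (s : lattice)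
    (hs : (s : ℂ × ℂ) = ((a : ℂ) + b * ρ, (c : ℂ) + d * ρ)) :
    σ n j δ s = (a + b) • δ + (c + d) • (j • δ) := by
  let g : Fin 4 → lattice := fun i => ⟨v i, Submodule.subset_span (Set.mem_range_self i)⟩
  have hs' : s = a • g 0 + b • g 1 + c • g 2 + d • g 3 := by
    apply Subtype.ext
    rw [hs]
    ext1 <;> simp [g, v]
  have h0 : σ n j δ (g 0) = δ := σ_apply n j δ 0
  have h1 : σ n j δ (g 1) = δ := σ_apply n j δ 1
  have h2 : σ n j δ (g 2) = j • δ := σ_apply n j δ 2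
  have h3 : σ n j δ (g 3) = j • δ := σ_apply n j δ 3
  rw [hs', map_add, map_add, map_add, map_zsmul, map_zsmul, map_zsmul, map_zsmul, h0, h1, h2, h3,
    add_smul, add_smul]
  abel

theorem mem_map_lineLattice {i : Fin 4} {y : ZMod (3 ^ n)} :
    y ∈ (lineLattice i).map (σ n j δ) ↔ ∃ a b c d : ℤ,
      lineForm i ((a : ℂ) + b * ρ, (c : ℂ) + d * ρ) = 0 ∧ (a + b) • δ + (c + d) • (j • δ) = y := by
  rw [AddSubgroup.mem_map]
  constructor
  · rintro ⟨s, hs, rfl⟩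
    obtain ⟨a, b, c, d, h⟩ := mem_lattice_iff.mp s.2
    refine ⟨a, b, c, d, ?_, (σ_eq n j δ a b c d s h).symm⟩
    rw [← h]
    exact hs
  · rintro ⟨a, b, c, d, h, rfl⟩
    exact ⟨⟨_, mem_lattice_iff.mpr ⟨a, b, c, d, rfl⟩⟩, h, σ_eq n j δ a b c d _ rfl⟩

theorem map_lineLattice_zero : (lineLattice 0).map (σ n j δ) = AddSubgroup.zmultiples δ := by
  ext y
  rw [mem_map_lineLattice, AddSubgroup.mem_zmultiples_iff]
  constructor
  · rintro ⟨a, b, c, d, h, rfl⟩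
    obtain ⟨rfl, rfl⟩ := int_add_mul_ρ_eq_zero (a := c) (b := d) h
    exact ⟨a + b, by simp⟩
  · rintro ⟨k, rfl⟩
    exact ⟨k, 0, 0, 0, by simp [lineForm], by simp⟩

theorem map_lineLattice_one :
    (lineLattice 1).map (σ n j δ) = AddSubgroup.zmultiples (j • δ) := by
  ext y
  rw [mem_map_lineLattice, AddSubgroup.mem_zmultiples_iff]
  constructor
  · rintro ⟨a, b, c, d, h, rfl⟩
    obtain ⟨rfl, rfl⟩ := int_add_mul_ρ_eq_zero (a := a) (b := b) h
    exact ⟨c + d, by simp⟩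
  · rintro ⟨k, rfl⟩
    exact ⟨0, 0, k, 0, by simp [lineForm], by simp⟩

theorem map_lineLattice_two :
    (lineLattice 2).map (σ n j δ) = AddSubgroup.zmultiples ((j + 1) • δ) := by
  ext y
  rw [mem_map_lineLattice, AddSubgroup.mem_zmultiples_iff]
  constructor
  · rintro ⟨a, b, c, d, h, rfl⟩
    have h' : ((c - a : ℤ) : ℂ) + (d - b : ℤ) * ρ = 0 := by
      have h2 : (c : ℂ) + d * ρ - (a + b * ρ) = 0 := h
      push_cast
      linear_combination h2
    obtain ⟨h1, h2⟩ := int_add_mul_ρ_eq_zero h'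
    obtain rfl : c = a := by omega
    obtain rfl : d = b := by omega
    refine ⟨c + d, ?_⟩
    rw [add_smul j 1 δ, one_smul, smul_add, add_comm]
  · rintro ⟨k, rfl⟩
    refine ⟨k, 0, k, 0, by simp [lineForm], ?_⟩
    rw [add_smul j 1 δ, one_smul, smul_add, add_comm, add_zero]

/-- This is the identity ζ(a + bρ) = (a - b) + aρ, read through `σ_eq`. -/
theorem mem_map_lineLattice_three {y : ZMod (3 ^ n)} : y ∈ (lineLattice 3).map (σ n j δ) ↔
    ∃ a b : ℤ, (a * (1 + 2 * j) + b * (1 - j)) • δ = y := by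
  rw [mem_map_lineLattice]
  have key : ∀ a b : ℤ, (a + b) • δ + (a - b + a) • (j • δ) =
      (a * (1 + 2 * j) + b * (1 - j)) • δ := by
    intro a b
    rw [← natCast_zsmul δ j, smul_smul, ← add_smul]
    congr 1
    ring
  constructor
  · rintro ⟨a, b, c, d, h, rfl⟩
    have h' : ((c - (a - b) : ℤ) : ℂ) + (d - a : ℤ) * ρ = 0 := by
      have h2 : (c : ℂ) + d * ρ - ζ * (a + b * ρ) = 0 := h
      rw [ζ_eq_one_add_ρ] at h2
      push_cast
      linear_combination h2 + b * ρ_sq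
    obtain ⟨h1, h2⟩ := int_add_mul_ρ_eq_zero h'
    obtain rfl : d = a := by omega
    obtain rfl : c = d - b := by omega
    exact ⟨d, b, (key d b).symm⟩
  · rintro ⟨a, b, rfl⟩
    refine ⟨a, b, a - b, a, ?_, key a b⟩
    have h2 : ((a - b : ℤ) : ℂ) + a * ρ - ζ * (a + b * ρ) = 0 := by
      rw [ζ_eq_one_add_ρ]
      push_cast
      linear_combination -b * ρ_sq
    exact h2

variable {n j δ}

theorem index_zmultiples_nsmul (hδ : AddSubgroup.zmultiples δ = ⊤) (m : ℕ) :
    (AddSubgroup.zmultiples (m • δ)).index = Nat.gcd m (3 ^ n) := by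
  have hord : addOrderOf δ = 3 ^ n := by
    rw [← Nat.card_zmultiples, hδ, AddSubgroup.card_top, Nat.card_zmod]
  have h := (AddSubgroup.zmultiples (m • δ)).card_mul_index
  rw [Nat.card_zmultiples, addOrderOf_nsmul, hord, Nat.card_zmod, Nat.gcd_comm] at h
  have hpos : 0 < 3 ^ n := by positivity
  have hdvd : Nat.gcd m (3 ^ n) ∣ 3 ^ n := Nat.gcd_dvd_right _ _
  have hg := Nat.div_mul_cancel hdvd
  have hq : 0 < 3 ^ n / Nat.gcd m (3 ^ n) :=
    Nat.div_pos (Nat.le_of_dvd hpos hdvd) (Nat.pos_of_dvd_of_pos hdvd hpos)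
  exact Nat.eq_of_mul_eq_mul_left hq (h.trans hg.symm)

/-- If j ≡ 1 mod 3, then 3 divides both 1 + 2j and 1 - j. Otherwise 1 - j is a unit modulo 3ⁿ. -/
theorem map_lineLattice_three (hδ : AddSubgroup.zmultiples δ = ⊤) :
    (lineLattice 3).map (σ n j δ) =
      if j ≡ 1 [MOD 3] then AddSubgroup.zmultiples (3 • δ) else ⊤ := by
  split_ifs with hj
  · have hj' : (3 : ℤ) ∣ j - 1 := by
      have := (Nat.modEq_iff_dvd.mp hj.symm)
      exact_mod_cast this
    obtain ⟨m, hm⟩ := hj'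
    have hjm : (j : ℤ) = 3 * m + 1 := by omega
    ext y
    rw [mem_map_lineLattice_three, AddSubgroup.mem_zmultiples_iff, hjm]
    constructor
    · rintro ⟨a, b, rfl⟩
      refine ⟨a * (1 + 2 * m) - b * m, ?_⟩
      rw [← natCast_zsmul δ 3, smul_smul]
      congr 1
      push_cast
      ring
    · rintro ⟨k, rfl⟩
      -- The witness comes from (1 + 2j) + 2(1 - j) = 3.
      refine ⟨k, 2 * k, ?_⟩
      rw [← natCast_zsmul δ 3, smul_smul]
      congr 1
      push_cast
      ring
  · rw [AddSubgroup.eq_top_iff']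
    intro y
    have hy : y ∈ AddSubgroup.zmultiples δ := hδ ▸ AddSubgroup.mem_top y
    obtain ⟨k, rfl⟩ := AddSubgroup.mem_zmultiples_iff.mp hy
    have hcop : IsCoprime (1 - j : ℤ) ((3 ^ n : ℕ) : ℤ) := by
      push_cast
      refine IsCoprime.pow_right ?_
      rw [isCoprime_comm, Prime.coprime_iff_not_dvd Int.prime_three]
      intro h
      exact hj (Nat.ModEq.symm (Nat.modEq_iff_dvd.mpr (by
        have := dvd_neg.mpr h
        rw [neg_sub] at this
        exact_mod_cast this)))
    obtain ⟨u, w, huw⟩ := hcop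
    rw [mem_map_lineLattice_three]
    refine ⟨0, k * u, ?_⟩
    have h0 : ((3 ^ n : ℕ) : ℤ) • δ = 0 := by
      rw [natCast_zsmul, nsmul_eq_mul, ZMod.natCast_self, zero_mul]
    have e : 0 * (1 + 2 * (j : ℤ)) + k * u * (1 - j) = k + (-(k * w)) * ((3 ^ n : ℕ) : ℤ) := by
      linear_combination k * huw
    rw [e, add_smul, mul_smul _ _ δ, h0, smul_zero, add_zero]

theorem σ_surjective (hδ : AddSubgroup.zmultiples δ = ⊤) : Function.Surjective (σ n j δ) := by
  intro y
  have hy : y ∈ (lineLattice 0).map (σ n j δ) := by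
    rw [map_lineLattice_zero, hδ]
    exact AddSubgroup.mem_top y
  obtain ⟨s, -, hs⟩ := hy
  exact ⟨s, hs⟩

/-- Adding the kernel gives the preimage of the image, and `σ` is surjective. -/
theorem index_ker_sup (hδ : AddSubgroup.zmultiples δ = ⊤) (i : Fin 4) :
    ((σ n j δ).ker ⊔ lineLattice i).index = ((lineLattice i).map (σ n j δ)).index := by
  rw [sup_comm, ← AddSubgroup.comap_map_eq,
    AddSubgroup.index_comap_of_surjective _ (σ_surjective hδ)]

theorem numEnds_Ynj (hδ : AddSubgroup.zmultiples δ = ⊤) :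
    numEnds (Ynj n j δ) = 1 + Nat.gcd j (3 ^ n) + Nat.gcd (j + 1) (3 ^ n) +
      if j ≡ 1 [MOD 3] then Nat.gcd 3 (3 ^ n) else 1 := by
  have hfin : (σ n j δ).ker.FiniteIndex := inferInstance
  have h := numEnds_cover (σ n j δ).ker
  rw [Fin.sum_univ_four, index_ker_sup hδ, index_ker_sup hδ, index_ker_sup hδ, index_ker_sup hδ,
    map_lineLattice_zero, map_lineLattice_one, map_lineLattice_two, map_lineLattice_three hδ, hδ,
    AddSubgroup.index_top, index_zmultiples_nsmul hδ, index_zmultiples_nsmul hδ] at h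
  refine h.trans ?_
  congr 1
  split_ifs
  · exact index_zmultiples_nsmul hδ 3
  · exact AddSubgroup.index_top

end

theorem gcd_three_pow_eq_one {m : ℕ} (n : ℕ) (hm : ¬ 3 ∣ m) : Nat.gcd m (3 ^ n) = 1 :=
  ((Nat.prime_three.coprime_iff_not_dvd.mpr hm).symm).pow_right n

end HirzebruchCover

end

theorem proposition3p2 (n j : ℕ) (hj : j < 3 ^ n) (δ : ZMod (3 ^ n))
    (hδ : AddSubgroup.zmultiples δ = ⊤) :
    (j ≡ 1 [MOD 3] → numEnds (HirzebruchCover.Ynj n j δ) = 6) ∧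
    (j ≡ 2 [MOD 3] → numEnds (HirzebruchCover.Ynj n j δ) = 3 + Nat.gcd (j + 1) (3 ^ n)) ∧
    (j ≡ 0 [MOD 3] → numEnds (HirzebruchCover.Ynj n j δ) = 3 + Nat.gcd j (3 ^ n)) := by
  open HirzebruchCover in
  rw [numEnds_Ynj hδ]
  refine ⟨fun h => ?_, fun h => ?_, fun h => ?_⟩
  -- For `n = 0` the last term gcd(3, 3ⁿ) would be 1 instead of 3; the bound on `j` excludes this
  -- case.
  · have hn : n ≠ 0 := by
      rintro rfl
      obtain rfl : j = 0 := by simpa using hj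
      exact absurd h (by decide)
    have hmod : j % 3 = 1 := h
    rw [if_pos h, gcd_three_pow_eq_one n (by omega), gcd_three_pow_eq_one n (by omega),
      Nat.gcd_eq_left (dvd_pow_self 3 hn)]
  · have hmod : j % 3 = 2 := h
    rw [if_neg (fun h' : j ≡ 1 [MOD 3] => by rw [Nat.ModEq] at h'; omega), gcd_three_pow_eq_one n (by omega)]
    ring
  · have hmod : j % 3 = 0 := h
    rw [if_neg (fun h' : j ≡ 1 [MOD 3] => by rw [Nat.ModEq] at h'; omega),
      gcd_three_pow_eq_one (m := j + 1) n (by omega)]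
    ring
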